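/- Write $\mathbb D=\{z\in\mathbb C:|z|<1\}$ and $\Delta=\partial\bar\partial=\frac14\left(\partial_x^2+\partial_y^2\right)$. For a sequence $w=(w_n)_{n\ge0}$ of positive numbers let $H^2_w$ be the Hilbert space of power series $f=\sum_{n\ge0} a_nz^n$ with $\|f\|_w^2=\sum_n|a_n|^2w_n<\infty$. The backward shift on $H^2_w$ is the adjoint of the forward shift $f\mapsto zf$. Let $H^2=H^2_{\mathbf 1}$ be the Hardy space ($w_n=1$ for all $n$), with backward shift $S^*f=(f-f(0))/z$. For an operator $T$ whose eigenspaces $\ker(T-\lambda I)$, $\lambda\in\mathbb D$, are one-dimensional and depend holomorphically on $\lambda$, these eigenspaces form a holomorphic Hermitian line bundle over $\mathbb D$, the eigenvector bundle of $T$; its curvature is $\kappa_T(z)=-\Delta\ln\|\gamma(z)\|^2$, where $\gamma$ is any nowhere vanishing local holomorphic section. **Theorem.** Let $\alpha>0$. There are non-negative integers $N_1,N_2,\dots$ with $N_k+2k<N_{k+1}$ for all $k\ge1$ such that, for the weight $w$ given by $$\ln w_n=\begin{cases}2j\ln(1+\alpha), & n=N_k+j \text{ or } n=N_k+2k-j,\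 \ 0\le j\le k,\ k\ge 1,\\ 0,&\text{otherwise,}\end{cases}$$ the backward shift $T$ on $H^2_w$ is a bounded operator with the following properties. 1. For every $\lambda\in\mathbb D$ the space $\ker(T-\lambda I)$ is one-dimensional, these spaces depend holomorphically on $\lambda\in\mathbb D$, and together they span a dense subspace of $H^2_w$. 2. $(1-\alpha)\|x\|\le\|T^*x\|\le(1+\alpha)\|x\|$ for all $x\in H^2_w$. 3. $T$ is not similar to $S^*$: there is no bounded operator $A:H^2_w\to H^2$ with bounded inverse and $AT=S^*A$. 4. The eigenvector bundles of $S^*$ and $T$ are uniformly equivalent: there are a bijective holomorphic bundle map $\Psi$ from the eigenvector bundle of $S^*$ to that of $T$ and a constant $c>0$ such that $\frac1c\|v\|\le\|\Psi(v)\|\le c\|v\|$ for all $\lambda\in\mathbb D$ and all $v\in\ker(S^*-\lambda I)$. 5. There is a bounded subharmonic function $\varphi\in C^2(\mathbb D)$ with $\Delta\varphi(z)=|\kappa_{S^*}(z)-\kappa_T(z)|$ for all $z\in\mathbb D$. 6. The measure $d\mu=|\kappa_{S^*}(z)-\kappa_T(z)|\,(1-|z|)\,dx\,dy$ on $\mathbb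 D$ is a Carleson measure, i.e. there is a constant $c$ with $\mu(Q_I)\le c\,\frac{|I|}{2\pi}$ for every arc $I$ of the unit circle, of length $|I|>0$, where $Q_I=\{z:\ |z|\le1,\ z/|z|\in I,\ 1-|z|\le\frac{|I|}{2\pi}\}$; and there is a constant $C$ with $|\kappa_{S^*}(z)-\kappa_T(z)|^{1/2}\le\frac{C}{1-|z|}$ for all $z\in\mathbb D$. -/

import Mathlib

open scoped ComplexInnerProductSpace PowerSeries Topology
open Complex MeasureTheory

/-! ### Weighted Hardy spaces -/

/-- A weight sequence: positive real numbers `w 0, w 1, …`. -/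
structure HardyWeight where
  toFun : ℕ → ℝ
  pos : ∀ n, 0 < toFun n

instance : CoeFun HardyWeight (fun _ => ℕ → ℝ) := ⟨HardyWeight.toFun⟩

/-- The weight that is constantly `1`. -/
def HardyWeight.one : HardyWeight := ⟨fun _ => 1, fun _ => one_pos⟩

lemma weighted_coeff_memlp_iff (w : HardyWeight) (a : ℕ → ℂ) :
    Memℓp (fun n => (Real.sqrt (w n) : ℂ) * a n) 2 ↔ Summable fun n => ‖a n‖ ^ 2 * w n := by
  rw [memℓp_gen_iff (by norm_num)]
  refine summable_congr fun n => ?_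
  have h : ‖(Real.sqrt (w n) : ℂ)‖ ^ 2 = w n := by
    rw [Complex.norm_real, Real.norm_eq_abs, sq_abs, Real.sq_sqrt (w.pos n).le]
  simp only [ENNReal.toReal_ofNat, Real.rpow_ofNat, norm_mul, mul_pow, h]
  ring

/-- The weighted Hardy space `H²_w`: all power series `f = ∑ aₙ zⁿ` with `∑ |aₙ|² wₙ < ∞`. -/
def weightedHardy (w : HardyWeight) : Submodule ℂ ℂ⟦X⟧ where
  carrier := {f | Summable fun n => ‖PowerSeries.coeff n f‖ ^ 2 * w n}
  add_mem' := by
    intro f g hf hg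
    have h := ((weighted_coeff_memlp_iff w _).2 hf).add ((weighted_coeff_memlp_iff w _).2 hg)
    refine (weighted_coeff_memlp_iff w _).1 ?_
    convert h using 1
    ext n
    simp [mul_add]
  zero_mem' := by simp [summable_zero]
  smul_mem' := by
    intro c f hf
    have h := Summable.mul_left (‖c‖ ^ 2) hf
    refine h.congr fun n => ?_
    simp [mul_pow, mul_assoc]

/-- The isometric embedding `∑ aₙ zⁿ ↦ (√wₙ aₙ)ₙ` of `H²_w` in `ℓ²`, which defines the Hilbert space
structure of `H²_w`. -/
noncomputable def weightedHardyToLp (w : HardyWeight) :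
    weightedHardy w →ₗ[ℂ] lp (fun _ : ℕ => ℂ) 2 where
  toFun f := ⟨fun n => (Real.sqrt (w n) : ℂ) * PowerSeries.coeff n (f : ℂ⟦X⟧),
    (weighted_coeff_memlp_iff w _).2 f.2⟩
  map_add' f g := by
    ext n
    change _ * PowerSeries.coeff n ((f : ℂ⟦X⟧) + (g : ℂ⟦X⟧)) = _ * _ + _ * _
    rw [map_add, mul_add]
  map_smul' c f := by ext n; simp; ring

lemma weightedHardyToLp_apply (w : HardyWeight) (f : weightedHardy w) (n : ℕ) :
    weightedHardyToLp w f n = (Real.sqrt (w n) : ℂ) * PowerSeries.coeff n (f : ℂ⟦X⟧) := rfl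

lemma HardyWeight.sqrt_ne_zero (w : HardyWeight) (n : ℕ) : (Real.sqrt (w n) : ℂ) ≠ 0 :=
  Complex.ofReal_ne_zero.2 (Real.sqrt_pos.2 (w.pos n)).ne'

lemma weightedHardyToLp_injective (w : HardyWeight) :
    Function.Injective (weightedHardyToLp w) := by
  intro f g h
  refine Subtype.ext (PowerSeries.ext fun n => ?_)
  have h' : weightedHardyToLp w f n = weightedHardyToLp w g n := by rw [h]
  simpa [weightedHardyToLp_apply, w.sqrt_ne_zero n] using h'

lemma weightedHardyToLp_surjective (w : HardyWeight) :
    Function.Surjective (weightedHardyToLp w) := by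
  intro a
  have h : (fun n => (Real.sqrt (w n) : ℂ) * ((Real.sqrt (w n) : ℂ)⁻¹ * a n)) = a := by
    ext n
    rw [mul_inv_cancel_left₀ (w.sqrt_ne_zero n)]
  refine ⟨⟨PowerSeries.mk fun n => (Real.sqrt (w n) : ℂ)⁻¹ * a n, ?_⟩, ?_⟩
  · change Summable _
    simp only [PowerSeries.coeff_mk]
    refine (weighted_coeff_memlp_iff w _).1 ?_
    rw [h]
    exact lp.memℓp a
  · ext n
    rw [weightedHardyToLp_apply, PowerSeries.coeff_mk, mul_inv_cancel_left₀ (w.sqrt_ne_zero n)]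

noncomputable instance weightedHardyNormedAddCommGroup (w : HardyWeight) :
    NormedAddCommGroup (weightedHardy w) :=
  NormedAddCommGroup.induced (weightedHardy w) (lp (fun _ : ℕ => ℂ) 2)
    (weightedHardyToLp w) (weightedHardyToLp_injective w)

/-- The inner product of `H²_w` is `⟪f, g⟫ = ∑ conj aₙ bₙ wₙ`
(linear in the second variable, as everywhere in Mathlib). -/
noncomputable instance weightedHardyInnerProductSpace (w : HardyWeight) :
    InnerProductSpace ℂ (weightedHardy w) where
  norm_smul_le c f := by
    change ‖weightedHardyToLp w (c • f)‖ ≤ ‖c‖ * ‖weightedHardyToLp w f‖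
    rw [map_smul, norm_smul]
  inner f g := ⟪weightedHardyToLp w f, weightedHardyToLp w g⟫
  norm_sq_eq_re_inner f := norm_sq_eq_re_inner (𝕜 := ℂ) (weightedHardyToLp w f)
  conj_inner_symm f g := inner_conj_symm _ _
  add_left f g h := by simp only [map_add, inner_add_left]
  smul_left f g c := by simp only [map_smul, inner_smul_left]

lemma weightedHardyToLp_isometry (w : HardyWeight) : Isometry (weightedHardyToLp w) :=
  AddMonoidHomClass.isometry_of_norm (weightedHardyToLp w) fun _ => rfl

instance weightedHardyCompleteSpace (w : HardyWeight) : CompleteSpace (weightedHardy w) :=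
  ((weightedHardyToLp_isometry w).isUniformInducing.completeSpace_congr
    (weightedHardyToLp_surjective w)).2 inferInstance

/-- `‖f‖²_w = ∑ |aₙ|² wₙ`. -/
lemma weightedHardy_hasSum_norm_sq (w : HardyWeight) (f : weightedHardy w) :
    HasSum (fun n => ‖PowerSeries.coeff n (f : ℂ⟦X⟧)‖ ^ 2 * w n) (‖f‖ ^ 2) := by
  have h := lp.hasSum_norm (p := 2) (by norm_num) (weightedHardyToLp w f)
  have e : ‖weightedHardyToLp w f‖ = ‖f‖ := rfl
  rw [e] at h
  simp only [ENNReal.toReal_ofNat, Real.rpow_ofNat] at h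
  convert h using 2 with n
  rw [weightedHardyToLp_apply, norm_mul, mul_pow, Complex.norm_real, Real.norm_eq_abs, sq_abs,
    Real.sq_sqrt (w.pos n).le, mul_comm]

/-! ### Shifts -/

/-- `T` is the backward shift of `H²_w`: the (Hilbert space) adjoint of `T` is the forward shift
`f ↦ z f`. -/
def IsBackwardShift {w : HardyWeight} (T : weightedHardy w →L[ℂ] weightedHardy w) : Prop :=
  ∀ f : weightedHardy w,
    ((ContinuousLinearMap.adjoint T f : weightedHardy w) : ℂ⟦X⟧) = PowerSeries.X * (f : ℂ⟦X⟧)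

/-- The Hardy space `H²` of power series with square summable coefficients. -/
abbrev HardySpace : Type := weightedHardy HardyWeight.one

lemma hardy_shift_summable (f : HardySpace) :
    Summable fun n => ‖PowerSeries.coeff (n + 1) (f : ℂ⟦X⟧)‖ ^ 2 * HardyWeight.one n :=
  (summable_nat_add_iff 1).2 f.2

/-- The backward shift `S* f = (f - f(0)) / z` on `H²`, that is, `∑ aₙ zⁿ ↦ ∑ aₙ₊₁ zⁿ`. -/
noncomputable def hardyBackwardShift : HardySpace →L[ℂ] HardySpace :=
  LinearMap.mkContinuous
    { toFun := fun f => ⟨PowerSeries.mk fun n => PowerSeries.coeff (n + 1) (f : ℂ⟦X⟧), by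
        change Summable _
        simpa only [PowerSeries.coeff_mk] using hardy_shift_summable f⟩
      map_add' := fun f g => by ext n; simp
      map_smul' := fun c f => by ext n; simp }
    1 (by
      intro f
      rw [one_mul]
      refine le_of_sq_le_sq ?_ (norm_nonneg f)
      have h := weightedHardy_hasSum_norm_sq HardyWeight.one f
      rw [← (weightedHardy_hasSum_norm_sq HardyWeight.one _).tsum_eq, ← h.tsum_eq,
        h.summable.tsum_eq_zero_add]
      simp only [LinearMap.coe_mk, AddHom.coe_mk, PowerSeries.coeff_mk]
      exact le_add_of_nonneg_left (by simp [HardyWeight.one]))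

/-! ### Eigenvector bundles -/

section Bundle

variable {H : Type*} [NormedAddCommGroup H] [InnerProductSpace ℂ H]

/-- The eigenspace `ker (T - z)`, the fibre over `z` of the eigenvector bundle of `T`. -/
abbrev eigenFibre (T : H →L[ℂ] H) (z : ℂ) : Submodule ℂ H :=
  LinearMap.ker (T - z • ContinuousLinearMap.id ℂ H : H →L[ℂ] H).toLinearMap

/-- `γ` is, near the point `z`, a nowhere vanishing holomorphic section that spans the eigenvector
bundle of `T`. -/
def IsHolomorphicFrameAt (T : H →L[ℂ] H) (γ : ℂ → H) (z : ℂ) : Prop :=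
  ∀ᶠ u in 𝓝 z, DifferentiableAt ℂ γ u ∧ γ u ≠ 0 ∧ eigenFibre T u = Submodule.span ℂ {γ u}

/-- The eigenvector bundle of `T` over the unit disk is a holomorphic line bundle, and its fibres
span a dense subspace. -/
structure HasEigenLineBundle (T : H →L[ℂ] H) : Prop where
  finrank_eq_one : ∀ z ∈ Metric.ball (0 : ℂ) 1, Module.finrank ℂ (eigenFibre T z) = 1
  dense_span : (⨆ z ∈ Metric.ball (0 : ℂ) 1, eigenFibre T z).topologicalClosure = ⊤
  holomorphic : ∀ z ∈ Metric.ball (0 : ℂ) 1, ∃ γ : ℂ → H, IsHolomorphicFrameAt T γ z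

/-- The normalized Laplacian `(∂²/∂x² + ∂²/∂y²) / 4` of a function on the plane. -/
noncomputable def normalizedLaplacian (φ : ℂ → ℝ) (z : ℂ) : ℝ :=
  (1 / 4) * Laplacian.laplacian φ z

open Classical in
/-- The curvature `κ_T(z) = -Δ ln ‖γ(z)‖²` of the eigenvector bundle of `T`, where `γ` is a local
nowhere vanishing holomorphic section. The value does not depend on `γ`, see
`eigenCurvature_eq`; it is `0` by convention where there is no such section. -/
noncomputable def eigenCurvature (T : H →L[ℂ] H) (z : ℂ) : ℝ :=
  if h : ∃ γ : ℂ → H, IsHolomorphicFrameAt T γ z then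
    -normalizedLaplacian (fun u => Real.log (‖h.choose u‖ ^ 2)) z
  else 0

lemma log_norm_sq_contDiffAt {γ : ℂ → H} {z : ℂ} [CompleteSpace H]
    (h : ∀ᶠ u in 𝓝 z, DifferentiableAt ℂ γ u) (h0 : γ z ≠ 0) :
    ContDiffAt ℝ 2 (fun u => Real.log (‖γ u‖ ^ 2)) z := by
  have h1 : ContDiffAt ℝ 2 γ z :=
    ((Complex.analyticAt_iff_eventually_differentiableAt.2 h).contDiffAt (n := 2)).restrict_scalars ℝ
  exact (h1.norm_sq ℂ).log (by simpa using h0)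

/-- The curvature may be computed from any local holomorphic frame. -/
lemma eigenCurvature_eq [CompleteSpace H] {T : H →L[ℂ] H} {γ : ℂ → H} {z : ℂ}
    (hγ : IsHolomorphicFrameAt T γ z) :
    eigenCurvature T z = -normalizedLaplacian (fun u => Real.log (‖γ u‖ ^ 2)) z := by
  have hex : ∃ γ : ℂ → H, IsHolomorphicFrameAt T γ z := ⟨γ, hγ⟩
  rw [eigenCurvature, dif_pos hex]
  have hβ := hex.choose_spec
  generalize hex.choose = β at hβ
  have hγz := hγ.self_of_nhds
  have hβz := hβ.self_of_nhds
  have key : ∀ᶠ u in 𝓝 z, ⟪γ z, γ u⟫ ≠ 0 := by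
    have hc : ContinuousAt (fun u => ⟪γ z, γ u⟫) z :=
      continuousAt_const.inner hγz.1.continuousAt
    exact hc.eventually_ne (by simpa using hγz.2.1)
  set g : ℂ → ℂ := fun u => ⟪γ z, β u⟫ / ⟪γ z, γ u⟫ with hg
  have hfac : ∀ᶠ u in 𝓝 z, β u = g u • γ u := by
    filter_upwards [hγ, hβ, key] with u h1 h2 h3
    have hm : β u ∈ Submodule.span ℂ {γ u} := by
      rw [← h1.2.2, h2.2.2]
      exact Submodule.mem_span_singleton_self _
    obtain ⟨c, hc⟩ := Submodule.mem_span_singleton.1 hm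
    have : g u = c := by
      simp only [hg, ← hc, inner_smul_right]
      exact mul_div_cancel_right₀ c h3
    rw [this, hc]
  have hgd : ∀ᶠ u in 𝓝 z, DifferentiableAt ℂ g u := by
    filter_upwards [hγ, hβ, key] with u h1 h2 h3
    exact (((innerSL ℂ (γ z)).differentiableAt.comp u h2.1)).div
      ((innerSL ℂ (γ z)).differentiableAt.comp u h1.1) h3
  have hgz : g z ≠ 0 := by
    intro h
    have := hfac.self_of_nhds
    rw [h, zero_smul] at this
    exact hβz.2.1 this
  have hharm := (Complex.analyticAt_iff_eventually_differentiableAt.2 hgd).harmonicAt_log_norm hgz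
  have hgne : ∀ᶠ u in 𝓝 z, g u ≠ 0 := hgd.self_of_nhds.continuousAt.eventually_ne hgz
  have heq : (fun u => Real.log (‖β u‖ ^ 2)) =ᶠ[𝓝 z]
      ((2 : ℝ) • fun u => Real.log ‖g u‖) + fun u => Real.log (‖γ u‖ ^ 2) := by
    filter_upwards [hfac, hγ, hgne] with u h1 h2 h3
    have h4 : ‖γ u‖ ≠ 0 := norm_ne_zero_iff.2 h2.2.1
    have h5 : ‖g u‖ ≠ 0 := norm_ne_zero_iff.2 h3
    simp only [h1, norm_smul, mul_pow, Pi.add_apply, Pi.smul_apply, smul_eq_mul]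
    rw [Real.log_mul (pow_ne_zero 2 h5) (pow_ne_zero 2 h4), Real.log_pow, Real.log_pow]
    simp
  have hlog := log_norm_sq_contDiffAt (hγ.mono fun u h => h.1) hγz.2.1
  have hharm2 := hharm.const_smul (c := (2 : ℝ))
  have h0 : Laplacian.laplacian ((2 : ℝ) • fun u => Real.log ‖g u‖) z = 0 :=
    hharm2.2.self_of_nhds
  rw [normalizedLaplacian, normalizedLaplacian,
    (InnerProductSpace.laplacian_congr_nhds heq).self_of_nhds,
    hharm2.1.laplacian_add hlog, h0, zero_add]

/-- Two operators are similar: `A T = S A` for some bounded invertible `A`. -/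
def AreSimilar {K : Type*} [NormedAddCommGroup K] [InnerProductSpace ℂ K]
    (T : H →L[ℂ] H) (S : K →L[ℂ] K) : Prop :=
  ∃ A : H ≃L[ℂ] K, ∀ x, A (T x) = S (A x)

/-- The eigenvector bundles of `S` and `T` over the unit disk are uniformly equivalent: there is a
bijective holomorphic bundle map `Ψ` between them, linear on each fibre and carrying holomorphic
sections to holomorphic sections, such that `c⁻¹ ‖v‖ ≤ ‖Ψ v‖ ≤ c ‖v‖` for all `v` in all fibres.
(The values of `Ψ` over points outside of the disk play no role.) -/
def UniformlyEquivalentBundles {K : Type*} [NormedAddCommGroup K] [InnerProductSpace ℂ K]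
    (S : K →L[ℂ] K) (T : H →L[ℂ] H) : Prop :=
  ∃ Ψ : ∀ z : ℂ, eigenFibre S z →ₗ[ℂ] eigenFibre T z,
    (∀ z ∈ Metric.ball (0 : ℂ) 1, Function.Bijective (Ψ z)) ∧
    (∀ U : Set ℂ, IsOpen U → U ⊆ Metric.ball (0 : ℂ) 1 → ∀ σ : ∀ z : ℂ, eigenFibre S z,
      DifferentiableOn ℂ (fun z => (σ z : K)) U →
        DifferentiableOn ℂ (fun z => (Ψ z (σ z) : H)) U) ∧
    ∃ c : ℝ, 0 < c ∧ ∀ z ∈ Metric.ball (0 : ℂ) 1, ∀ v : eigenFibre S z,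
      c⁻¹ * ‖v‖ ≤ ‖Ψ z v‖ ∧ ‖Ψ z v‖ ≤ c * ‖v‖

end Bundle

/-! ### Subharmonic functions and Carleson measures -/

/-- A real-valued function `φ` is subharmonic on `U`: it is upper semicontinuous and its value at the
centre of a closed disk in `U` is at most its mean over the boundary circle. -/
def IsSubharmonicOn (φ : ℂ → ℝ) (U : Set ℂ) : Prop :=
  UpperSemicontinuousOn φ U ∧
    ∀ z : ℂ, ∀ r : ℝ, 0 < r → Metric.closedBall z r ⊆ U →
      CircleIntegrable φ z r ∧ φ z ≤ Real.circleAverage φ z r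

/-- On the unit disk, the equation `Δφ = g` (for the normalized Laplacian) has a bounded subharmonic
classical solution `φ`. -/
def HasBoundedSubharmonicSolution (g : ℂ → ℝ) : Prop :=
  ∃ φ : ℂ → ℝ, ContDiffOn ℝ 2 φ (Metric.ball 0 1) ∧
    (∃ M : ℝ, ∀ z ∈ Metric.ball (0 : ℂ) 1, |φ z| ≤ M) ∧
    IsSubharmonicOn φ (Metric.ball 0 1) ∧
    ∀ z ∈ Metric.ball (0 : ℂ) 1, normalizedLaplacian φ z = g z

/-- The Carleson window over the arc `I = {e^{iθ} : a ≤ θ ≤ a + ℓ}` of length `ℓ`: the points `z` of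
the closed unit disk with `z / |z| ∈ I` and `1 - |z| ≤ ℓ / 2π`. -/
def carlesonWindow (a ℓ : ℝ) : Set ℂ :=
  {z | ‖z‖ ≤ 1 ∧ z / (‖z‖ : ℂ) ∈ (fun θ : ℝ => Complex.exp (θ * Complex.I)) '' Set.Icc a (a + ℓ) ∧
    1 - ‖z‖ ≤ ℓ / (2 * Real.pi)}

/-- A measure on the closed unit disk is a Carleson measure if the mass of each Carleson window is at
most a constant times the normalized length of its arc. -/
def IsCarlesonMeasure (μ : Measure ℂ) : Prop :=
  ∃ c : ℝ, 0 < c ∧ ∀ a ℓ : ℝ, 0 < ℓ → ℓ ≤ 2 * Real.pi →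
    μ (carlesonWindow a ℓ) ≤ ENNReal.ofReal (c * (ℓ / (2 * Real.pi)))

/-- The measure `g(z) dx dy` on the unit disk, for a nonnegative function `g`. -/
noncomputable def diskMeasure (g : ℂ → ℝ) : Measure ℂ :=
  (volume.restrict (Metric.ball (0 : ℂ) 1)).withDensity fun z => ENNReal.ofReal (g z)

/-! ### Spikes -/

/-- The weight with spikes of height `2 k ln (1 + α)` at the places `N k`, `k ≥ 1`: on the interval
`[N k, N k + 2 k]` the sequence `ln w` increases with slope `2 ln (1 + α)` from `0` to
`2 k ln (1 + α)` and then decreases with the opposite slope to `0`; outside of these intervals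
`ln w = 0`. -/
def HasSpikes (α : ℝ) (N : ℕ → ℕ) (w : HardyWeight) : Prop :=
  (∀ k ≥ 1, ∀ j ≤ k, Real.log (w (N k + j)) = 2 * j * Real.log (1 + α) ∧
      Real.log (w (N k + 2 * k - j)) = 2 * j * Real.log (1 + α)) ∧
    ∀ n, (∀ k ≥ 1, n ∉ Set.Icc (N k) (N k + 2 * k)) → Real.log (w n) = 0

/-!
For `w ≥ 1` the eigenvector of the backward shift on `H²_w` is `γ(z) = ∑ zⁿ ζⁿ / wₙ` (a power series
in `ζ`), so `‖γ(z)‖² = ∑ rⁿ / wₙ` with `r = |z|²`. Writing `cₙ = 1 - 1 / wₙ` and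
`Q(r) = ∑ cₙ rⁿ⁺¹ / (n + 1)`, the quotient of `‖γ(z)‖²` by the corresponding `1 / (1 - r)` of the
Hardy space is `F(r) = 1 - (1 - r) Q'(r)`, and the difference of the curvatures is
`Δ log F(|z|²) = h(|z|²)` with `h = (r u')'`, `u = log F` (`IsBackwardShift.eigenCurvature_sub`).

The tall spikes make the powers of `T` unbounded, so `T` is not similar to `S*`
(`IsBackwardShift.exists_weight_le_of_areSimilar`). If the spikes are sparse, however, then
`∑ cₙ / (n + 1) ≤ 1 / 4`, that is, `Q ≤ 1 / 4` on `[0, 1)`, and everything else follows from this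
bound. All derivatives of `Q` are nonnegative on `[0, 1)`, hence `(1 - r)ʲ Q⁽ʲ⁾(r)` is bounded for
each `j` (`IsAbsolutelyMonotone.pow_succ_mul_le`). In particular `1 / 2 ≤ F ≤ 1`, which gives the
uniform equivalence of the bundles, and `(1 - r)² |h|` is bounded. Moreover `(1 - r) |h|` is at most
a constant times `Q' + (1 - r) Q'' + (1 - r)² Q'''`, which is the derivative of the bounded function
`(1 - r)² Q'' + 3 (1 - r) Q' + 4 Q` (`IsAbsolutelyMonotone.abs_logDefect_laplacian_le`). Thus
`∫ (1 - r) |h| dr` is finite. In polar coordinates this is the Carleson condition for the radial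
density `|h(|z|²)| (1 - |z|)` (`isCarlesonMeasure_of_le_radial`), and it is also what makes the
radial solution of `Δ φ = |h|` bounded (`exists_bounded_radial_solution`). That solution is
subharmonic since it is an increasing convex function of `log |z|` (`radial_isSubharmonicOn`).
-/

/-! ### Power series with nonnegative coefficients -/

lemma summable_of_polynomial_growth {a : ℕ → ℝ} {C : ℝ} {k : ℕ}
    (ha : ∀ n, |a n| ≤ C * ((n : ℝ) + 1) ^ k) {r : ℝ} (hr : |r| < 1) :
    Summable fun n => |a n| * |r| ^ n := by
  have h1 : Summable fun n : ℕ => ((n : ℝ) + 1) ^ k * |r| ^ n := by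
    have h2 := summable_pow_mul_geometric_of_norm_lt_one (R := ℝ) k (r := |r|) (by simpa using hr)
    refine Summable.of_nonneg_of_le (fun n => by positivity) (fun n => ?_)
      ((h2.mul_left (2 ^ k)).add (summable_geometric_of_lt_one (abs_nonneg r) hr))
    rcases Nat.eq_zero_or_pos n with rfl | hn
    · simp only [Nat.cast_zero, zero_add, one_pow, pow_zero, mul_one]
      have : (0 : ℝ) ≤ 2 ^ k * 0 ^ k := by positivity
      linarith
    · have h3 : ((n : ℝ) + 1) ≤ 2 * n := by
        have : (1 : ℝ) ≤ n := by exact_mod_cast hn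
        linarith
      have h4 : ((n : ℝ) + 1) ^ k ≤ 2 ^ k * (n : ℝ) ^ k := by
        rw [← mul_pow]; gcongr
      have h5 : 0 ≤ |r| ^ n := by positivity
      nlinarith [mul_le_mul_of_nonneg_right h4 h5]
  refine Summable.of_nonneg_of_le (fun n => by positivity) (fun n => ?_) (h1.mul_left C)
  rw [← mul_assoc]
  gcongr
  exact ha n

/-- The coefficients of the derivative of the power series `∑ aₙ rⁿ`. -/
def derivCoeff (a : ℕ → ℝ) : ℕ → ℝ := fun n => ((n : ℝ) + 1) * a (n + 1)

lemma derivCoeff_polynomial_growth {a : ℕ → ℝ} {C : ℝ} {k : ℕ}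
    (ha : ∀ n, |a n| ≤ C * ((n : ℝ) + 1) ^ k) (n : ℕ) :
    |derivCoeff a n| ≤ (C * 2 ^ k) * ((n : ℝ) + 1) ^ (k + 1) := by
  have hC : 0 ≤ C := by simpa using (abs_nonneg _).trans (ha 0)
  have h1 := ha (n + 1)
  have h2 : (((n + 1 : ℕ) : ℝ) + 1) ^ k ≤ 2 ^ k * ((n : ℝ) + 1) ^ k := by
    rw [← mul_pow]
    gcongr
    push_cast
    linarith [(Nat.cast_nonneg n : (0 : ℝ) ≤ n)]
  rw [derivCoeff, abs_mul, abs_of_nonneg (by positivity : (0 : ℝ) ≤ (n : ℝ) + 1)]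
  calc ((n : ℝ) + 1) * |a (n + 1)| ≤ ((n : ℝ) + 1) * (C * (2 ^ k * ((n : ℝ) + 1) ^ k)) := by
        gcongr
        exact h1.trans (by gcongr)
    _ = _ := by ring

lemma hasDerivAt_tsum_mul_pow {a : ℕ → ℝ} {C : ℝ} {k : ℕ}
    (ha : ∀ n, |a n| ≤ C * ((n : ℝ) + 1) ^ k) {r : ℝ} (hr : |r| < 1) :
    HasDerivAt (fun x => ∑' n, a n * x ^ n) (∑' n, derivCoeff a n * r ^ n) r := by
  obtain ⟨ρ, hρ, hρ1⟩ := exists_between hr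
  have hρ0 : 0 < ρ := (abs_nonneg r).trans_lt hρ
  have hs := summable_of_polynomial_growth (derivCoeff_polynomial_growth ha) (r := ρ)
    (by rwa [abs_of_pos hρ0])
  rw [abs_of_pos hρ0] at hs
  have hu : Summable fun n : ℕ => |(n : ℝ) * a n| * ρ ^ (n - 1) := by
    refine (summable_nat_add_iff 1).1 (hs.congr fun n => ?_)
    simp [derivCoeff]
  have key := hasDerivAt_tsum_of_isPreconnected (t := Metric.ball (0 : ℝ) ρ)
    (g := fun n x => a n * x ^ n) (g' := fun n x => a n * (n * x ^ (n - 1))) (y₀ := 0) (y := r) hu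
    Metric.isOpen_ball (convex_ball _ _).isPreconnected
    (fun n y _ => (hasDerivAt_pow n y).const_mul _)
    (fun n y hy => by
      have hy' : |y| ≤ ρ := by simpa using (Metric.mem_ball.1 hy).le
      rw [Real.norm_eq_abs, ← mul_assoc, abs_mul, abs_pow, mul_comm (a n)]
      gcongr)
    (Metric.mem_ball_self hρ0)
    (summable_of_hasFiniteSupport ((Set.finite_singleton 0).subset fun n hn => by
      by_contra h
      exact hn (by simp [show n ≠ 0 from h])))
    (by simpa using hρ)
  have hsum : Summable fun n : ℕ => a n * (n * r ^ (n - 1)) := by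
    refine Summable.of_norm_bounded hu fun n => ?_
    rw [Real.norm_eq_abs, ← mul_assoc, abs_mul, abs_pow, mul_comm (a n)]
    gcongr
  have he : ∑' n : ℕ, a n * (n * r ^ (n - 1)) = ∑' n, derivCoeff a n * r ^ n := by
    rw [hsum.tsum_eq_zero_add]
    simp only [Nat.cast_zero, zero_mul, mul_zero, zero_add]
    refine tsum_congr fun n => ?_
    simp only [derivCoeff, Nat.add_sub_cancel]
    push_cast
    ring
  rw [← he]
  exact key

/-- The functions `Q 0, Q 1, …` are the successive derivatives of a function on `(-1, 1)` and are
nonnegative on `[0, 1)`. -/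
structure IsAbsolutelyMonotone (Q : ℕ → ℝ → ℝ) : Prop where
  hasDerivAt : ∀ j r, |r| < 1 → HasDerivAt (Q j) (Q (j + 1) r) r
  nonneg : ∀ j r, 0 ≤ r → r < 1 → 0 ≤ Q j r

/-- Integrating `∑ cₙ rⁿ` with nonnegative `cₙ` gives an absolutely monotone function, whose values
on `[0, 1)` are at most `∑ cₙ / (n + 1)`. -/
lemma exists_isAbsolutelyMonotone {c : ℕ → ℝ} (h0 : ∀ n, 0 ≤ c n) (h1 : ∀ n, c n ≤ 1)
    {M : ℝ} (hM : HasSum (fun n => c n / ((n : ℝ) + 1)) M) :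
    ∃ Q : ℕ → ℝ → ℝ, IsAbsolutelyMonotone Q ∧ (∀ r, 0 ≤ r → r < 1 → Q 0 r ≤ M) ∧
      ∀ r, Q 1 r = ∑' n, c n * r ^ n := by
  set a : ℕ → ℕ → ℝ := fun j => derivCoeff^[j] (fun n => c (n - 1) / n) with ha
  have hsucc : ∀ j, a (j + 1) = derivCoeff (a j) := fun j => Function.iterate_succ_apply' _ _ _
  have hpos : ∀ j n, 0 ≤ a j n := by
    intro j
    induction j with
    | zero => intro n; exact div_nonneg (h0 _) (Nat.cast_nonneg n)
    | succ j ih =>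
      intro n
      rw [hsucc]
      exact mul_nonneg (by positivity) (ih _)
  have hgrowth : ∀ j, ∃ C : ℝ, ∀ n, |a j n| ≤ C * ((n : ℝ) + 1) ^ j := by
    intro j
    induction j with
    | zero =>
      refine ⟨1, fun n => ?_⟩
      rw [abs_of_nonneg (hpos 0 n), pow_zero, mul_one]
      change c (n - 1) / (n : ℝ) ≤ 1
      rcases Nat.eq_zero_or_pos n with rfl | hn
      · simp
      · have : (1 : ℝ) ≤ n := by exact_mod_cast hn
        rw [div_le_one (by linarith)]
        exact (h1 _).trans this
    | succ j ih =>
      obtain ⟨C, hC⟩ := ih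
      exact ⟨C * 2 ^ j, fun n => by rw [hsucc]; exact derivCoeff_polynomial_growth hC n⟩
  refine ⟨fun j r => ∑' n, a j n * r ^ n, ⟨fun j r hr => ?_, fun j r hr0 _ => ?_⟩,
    fun r hr0 hr1 => ?_, fun r => ?_⟩
  · obtain ⟨C, hC⟩ := hgrowth j
    simp only [hsucc]
    exact hasDerivAt_tsum_mul_pow hC hr
  · exact tsum_nonneg fun n => mul_nonneg (hpos j n) (pow_nonneg hr0 n)
  · have hM' : HasSum (a 0) M := by
      refine (hasSum_nat_add_iff' 1).1 ?_
      simpa [ha] using hM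
    have hle : ∀ n, a 0 n * r ^ n ≤ a 0 n := fun n =>
      mul_le_of_le_one_right (hpos 0 n) (pow_le_one₀ hr0 hr1.le)
    rw [← hM'.tsum_eq]
    exact Summable.tsum_le_tsum hle (Summable.of_nonneg_of_le
      (fun n => mul_nonneg (hpos 0 n) (pow_nonneg hr0 n)) hle hM'.summable) hM'.summable
  · refine tsum_congr fun n => ?_
    rw [hsucc]
    have : ((n : ℝ) + 1) ≠ 0 := by positivity
    simp only [ha, derivCoeff, Function.iterate_zero, id_eq, Nat.add_sub_cancel]
    push_cast
    rw [mul_div_cancel₀ _ this]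

/-! ### Estimates for absolutely monotone functions -/

namespace IsAbsolutelyMonotone

variable {Q : ℕ → ℝ → ℝ}

lemma hasDerivAt' (hQ : IsAbsolutelyMonotone Q) (j : ℕ) {r : ℝ} (h0 : 0 ≤ r) (h1 : r < 1) :
    HasDerivAt (Q j) (Q (j + 1) r) r :=
  hQ.hasDerivAt j r (by rwa [abs_of_nonneg h0])

lemma exists_slope (hQ : IsAbsolutelyMonotone Q) (j : ℕ) {r s : ℝ} (h0 : 0 ≤ r) (hrs : r < s)
    (h1 : s < 1) : ∃ t ∈ Set.Ioo r s, Q j s - Q j r = (s - r) * Q (j + 1) t := by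
  obtain ⟨t, ht, h⟩ := exists_hasDerivAt_eq_slope (Q j) (Q (j + 1)) hrs
    (fun x hx =>
      (hQ.hasDerivAt' j (h0.trans hx.1) (hx.2.trans_lt h1)).continuousAt.continuousWithinAt)
    (fun x hx => hQ.hasDerivAt' j (h0.trans hx.1.le) (hx.2.trans h1))
  refine ⟨t, ht, ?_⟩
  rw [h, mul_div_cancel₀ _ (sub_pos.2 hrs).ne']

lemma mono (hQ : IsAbsolutelyMonotone Q) (j : ℕ) {r s : ℝ} (h0 : 0 ≤ r) (hrs : r ≤ s)
    (h1 : s < 1) : Q j r ≤ Q j s := by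
  rcases hrs.eq_or_lt with rfl | hlt
  · rfl
  obtain ⟨t, ht, h⟩ := hQ.exists_slope j h0 hlt h1
  have := mul_nonneg (sub_pos.2 hlt).le
    (hQ.nonneg (j + 1) t (h0.trans ht.1.le) (ht.2.trans h1))
  linarith

lemma mul_le_sub (hQ : IsAbsolutelyMonotone Q) (j : ℕ) {r s : ℝ} (h0 : 0 ≤ r) (hrs : r < s)
    (h1 : s < 1) : (s - r) * Q (j + 1) r ≤ Q j s - Q j r := by
  obtain ⟨t, ht, h⟩ := hQ.exists_slope j h0 hrs h1
  rw [h]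
  exact mul_le_mul_of_nonneg_left (hQ.mono (j + 1) h0 ht.1.le (ht.2.trans h1)) (sub_pos.2 hrs).le

lemma sub_le_mul (hQ : IsAbsolutelyMonotone Q) (j : ℕ) {r s : ℝ} (h0 : 0 ≤ r) (hrs : r < s)
    (h1 : s < 1) : Q j s - Q j r ≤ (s - r) * Q (j + 1) s := by
  obtain ⟨t, ht, h⟩ := hQ.exists_slope j h0 hrs h1
  rw [h]
  exact mul_le_mul_of_nonneg_left (hQ.mono (j + 1) (h0.trans ht.1.le) ht.2.le h1)
    (sub_pos.2 hrs).le

/-- A Cauchy type estimate: the growth of `Q (j + 1)` at `r` is controlled by the values of `Q j`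
at the midpoint of `r` and `1`. -/
lemma pow_succ_mul_le (hQ : IsAbsolutelyMonotone Q) (j : ℕ) {C : ℝ}
    (h : ∀ r, 0 ≤ r → r < 1 → (1 - r) ^ j * Q j r ≤ C) {r : ℝ} (h0 : 0 ≤ r) (h1 : r < 1) :
    (1 - r) ^ (j + 1) * Q (j + 1) r ≤ 2 ^ (j + 1) * C := by
  have hs0 : r < (1 + r) / 2 := by linarith
  have hs1 : (1 + r) / 2 < 1 := by linarith
  have e1 := hQ.mul_le_sub j h0 hs0 hs1
  have e2 := h _ (h0.trans hs0.le) hs1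
  have e3 := hQ.nonneg j r h0 h1
  have e4 : (1 - r) * Q (j + 1) r ≤ 2 * Q j ((1 + r) / 2) := by linarith
  have e5 : (1 - (1 + r) / 2) = (1 - r) / 2 := by ring
  rw [e5, div_pow, div_mul_eq_mul_div, div_le_iff₀ (by positivity)] at e2
  have e6 : 0 ≤ (1 - r) ^ j := by have : 0 ≤ 1 - r := by linarith
                                  positivity
  calc (1 - r) ^ (j + 1) * Q (j + 1) r = (1 - r) ^ j * ((1 - r) * Q (j + 1) r) := by ring
    _ ≤ (1 - r) ^ j * (2 * Q j ((1 + r) / 2)) := by gcongr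
    _ = 2 * ((1 - r) ^ j * Q j ((1 + r) / 2)) := by ring
    _ ≤ 2 * (C * 2 ^ j) := by gcongr
    _ = _ := by ring

lemma bound_one (hQ : IsAbsolutelyMonotone Q) (hM : ∀ r, 0 ≤ r → r < 1 → Q 0 r ≤ 1 / 4) {r : ℝ}
    (h0 : 0 ≤ r) (h1 : r < 1) : (1 - r) * Q 1 r ≤ 1 / 2 := by
  have := hQ.pow_succ_mul_le 0 (C := 1 / 4) (by simpa using hM) h0 h1
  norm_num at this
  linarith

lemma bound_two (hQ : IsAbsolutelyMonotone Q) (hM : ∀ r, 0 ≤ r → r < 1 → Q 0 r ≤ 1 / 4) {r : ℝ}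
    (h0 : 0 ≤ r) (h1 : r < 1) : (1 - r) ^ 2 * Q 2 r ≤ 2 := by
  have := hQ.pow_succ_mul_le 1 (C := 1 / 2)
    (fun s hs0 hs1 => by simpa using hQ.bound_one hM hs0 hs1) h0 h1
  norm_num at this
  linarith

lemma bound_three (hQ : IsAbsolutelyMonotone Q) (hM : ∀ r, 0 ≤ r → r < 1 → Q 0 r ≤ 1 / 4) {r : ℝ}
    (h0 : 0 ≤ r) (h1 : r < 1) : (1 - r) ^ 3 * Q 3 r ≤ 16 := by
  have := hQ.pow_succ_mul_le 2 (C := 2) (fun s hs0 hs1 => hQ.bound_two hM hs0 hs1) h0 h1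
  norm_num at this
  linarith

end IsAbsolutelyMonotone

/-- Near `r`, the function `u` is twice continuously differentiable with derivatives `u₁` and
`u₂`. -/
def HasTwoContDerivsAt (u u₁ u₂ : ℝ → ℝ) (r : ℝ) : Prop :=
  ∀ᶠ s in 𝓝 r, HasDerivAt u (u₁ s) s ∧ HasDerivAt u₁ (u₂ s) s ∧ ContinuousAt u₂ s

/-! ### The function `log (1 - (1 - r) Q'(r))` -/

/-- `F r = 1 - (1 - r) Q'(r)`; for `Q' = ∑ (1 - 1 / wₙ) rⁿ` this is `(1 - r) ∑ rⁿ / wₙ`. -/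
def defect (Q : ℕ → ℝ → ℝ) (r : ℝ) : ℝ := 1 - (1 - r) * Q 1 r

/-- The first derivative of `defect Q`. -/
def defectDeriv (Q : ℕ → ℝ → ℝ) (r : ℝ) : ℝ := Q 1 r - (1 - r) * Q 2 r

/-- The second derivative of `defect Q`. -/
def defectDeriv₂ (Q : ℕ → ℝ → ℝ) (r : ℝ) : ℝ := 2 * Q 2 r - (1 - r) * Q 3 r

/-- The first derivative of `log ∘ defect Q`. -/
noncomputable def logDefectDeriv (Q : ℕ → ℝ → ℝ) (r : ℝ) : ℝ := defectDeriv Q r / defect Q r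

/-- The second derivative of `log ∘ defect Q`. -/
noncomputable def logDefectDeriv₂ (Q : ℕ → ℝ → ℝ) (r : ℝ) : ℝ :=
  defectDeriv₂ Q r / defect Q r - (defectDeriv Q r / defect Q r) ^ 2

/-- A weight on `[0, 1)` with a bounded antiderivative that dominates `(1 - r) |(r u')'|` for
`u = log ∘ defect Q`. -/
def dominatingWeight (Q : ℕ → ℝ → ℝ) (r : ℝ) : ℝ :=
  16 * (Q 1 r + (1 - r) * Q 2 r + (1 - r) ^ 2 * Q 3 r)

/-- An antiderivative of `dominatingWeight Q`. -/
def dominatingPotential (Q : ℕ → ℝ → ℝ) (r : ℝ) : ℝ :=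
  16 * ((1 - r) ^ 2 * Q 2 r + 3 * (1 - r) * Q 1 r + 4 * Q 0 r)

namespace IsAbsolutelyMonotone

variable {Q : ℕ → ℝ → ℝ}

lemma hasDerivAt_defect (hQ : IsAbsolutelyMonotone Q) {r : ℝ} (hr : |r| < 1) :
    HasDerivAt (defect Q) (defectDeriv Q r) r := by
  have h := (((hasDerivAt_id r).const_sub 1).mul (hQ.hasDerivAt 1 r hr)).const_sub 1
  refine h.congr_deriv ?_
  simp [defectDeriv]
  ring

lemma hasDerivAt_defectDeriv (hQ : IsAbsolutelyMonotone Q) {r : ℝ} (hr : |r| < 1) :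
    HasDerivAt (defectDeriv Q) (defectDeriv₂ Q r) r := by
  have h := (hQ.hasDerivAt 1 r hr).sub
    (((hasDerivAt_id r).const_sub 1).mul (hQ.hasDerivAt 2 r hr))
  refine h.congr_deriv ?_
  simp [defectDeriv₂]
  ring

lemma half_le_defect (hQ : IsAbsolutelyMonotone Q) (hM : ∀ r, 0 ≤ r → r < 1 → Q 0 r ≤ 1 / 4)
    {r : ℝ} (h0 : 0 ≤ r) (h1 : r < 1) : 1 / 2 ≤ defect Q r := by
  have := hQ.bound_one hM h0 h1
  rw [defect]
  linarith

lemma defect_le_one (hQ : IsAbsolutelyMonotone Q) {r : ℝ} (h0 : 0 ≤ r) (h1 : r < 1) :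
    defect Q r ≤ 1 := by
  have := mul_nonneg (sub_pos.2 h1).le (hQ.nonneg 1 r h0 h1)
  rw [defect]
  linarith

lemma hasTwoContDerivsAt_logDefect (hQ : IsAbsolutelyMonotone Q)
    (hM : ∀ r, 0 ≤ r → r < 1 → Q 0 r ≤ 1 / 4) {r : ℝ} (h0 : 0 ≤ r) (h1 : r < 1) :
    HasTwoContDerivsAt (fun t => Real.log (defect Q t)) (logDefectDeriv Q) (logDefectDeriv₂ Q)
      r := by
  have hr : |r| < 1 := by rwa [abs_of_nonneg h0]
  have hpos : 0 < defect Q r := by linarith [hQ.half_le_defect hM h0 h1]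
  filter_upwards [continuous_abs.continuousAt.eventually_lt_const hr,
    (hQ.hasDerivAt_defect hr).continuousAt.eventually_const_lt hpos] with s hs1 hs2
  refine ⟨(hQ.hasDerivAt_defect hs1).log hs2.ne', ?_, ?_⟩
  · refine ((hQ.hasDerivAt_defectDeriv hs1).div (hQ.hasDerivAt_defect hs1) hs2.ne').congr_deriv ?_
    rw [logDefectDeriv₂]
    have := hs2.ne'
    field_simp
  · have c1 := (hQ.hasDerivAt_defect hs1).continuousAt
    have c2 := (hQ.hasDerivAt_defectDeriv hs1).continuousAt
    have c3 : ContinuousAt (defectDeriv₂ Q) s :=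
      ((hQ.hasDerivAt 2 s hs1).continuousAt.const_mul 2).sub
        ((continuousAt_const.sub continuousAt_id).mul (hQ.hasDerivAt 3 s hs1).continuousAt)
    exact (c3.div c1 hs2.ne').sub ((c2.div c1 hs2.ne').pow 2)

/-- Near the origin `(r u')' ≤ 0` for `u = log ∘ defect Q` if `Q'(0) = 0`: there `r F'` is
decreasing, because `Q' ≤ r Q''` by convexity. -/
lemma logDefect_laplacian_nonpos (hQ : IsAbsolutelyMonotone Q)
    (hM : ∀ r, 0 ≤ r → r < 1 → Q 0 r ≤ 1 / 4) (hz : Q 1 0 = 0) {r : ℝ} (h0 : 0 ≤ r)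
    (h1 : r ≤ 1 / 4) : logDefectDeriv Q r + r * logDefectDeriv₂ Q r ≤ 0 := by
  have hr1 : r < 1 := by linarith
  have hF : 0 < defect Q r := by linarith [hQ.half_le_defect hM h0 hr1]
  have hconv : Q 1 r ≤ r * Q 2 r := by
    rcases h0.eq_or_lt with rfl | hlt
    · simp [hz]
    · simpa [hz] using hQ.sub_le_mul 1 le_rfl hlt hr1
  have hQ2 := hQ.nonneg 2 r h0 hr1
  have hQ3 := hQ.nonneg 3 r h0 hr1
  have hneg : defectDeriv Q r + r * defectDeriv₂ Q r ≤ 0 := by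
    rw [defectDeriv, defectDeriv₂]
    have e1 : 0 ≤ (1 / 4 - r) * Q 2 r := mul_nonneg (by linarith) hQ2
    have e2 : 0 ≤ r * (1 - r) * Q 3 r := mul_nonneg (mul_nonneg h0 (by linarith)) hQ3
    linarith
  have e : logDefectDeriv Q r + r * logDefectDeriv₂ Q r =
      (defectDeriv Q r + r * defectDeriv₂ Q r) / defect Q r -
        r * (defectDeriv Q r / defect Q r) ^ 2 := by
    rw [logDefectDeriv, logDefectDeriv₂]; ring
  rw [e]
  have := div_nonpos_of_nonpos_of_nonneg hneg hF.le
  have := mul_nonneg h0 (sq_nonneg (defectDeriv Q r / defect Q r))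
  linarith

lemma dominatingWeight_nonneg (hQ : IsAbsolutelyMonotone Q) {r : ℝ} (h0 : 0 ≤ r) (h1 : r < 1) :
    0 ≤ dominatingWeight Q r := by
  have hs : 0 ≤ 1 - r := by linarith
  have := hQ.nonneg 1 r h0 h1
  have := hQ.nonneg 2 r h0 h1
  have := hQ.nonneg 3 r h0 h1
  rw [dominatingWeight]
  positivity

/-- The terms of `(r u')' = (r F')' / F - r (F' / F)²` that are linear in `F` are bounded termwise;
in the quadratic one a factor `(1 - r) |F'|` is bounded by `5 / 2`. -/
lemma abs_logDefect_laplacian_le (hQ : IsAbsolutelyMonotone Q)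
    (hM : ∀ r, 0 ≤ r → r < 1 → Q 0 r ≤ 1 / 4) {r : ℝ} (h0 : 0 ≤ r) (h1 : r < 1) :
    (1 - r) * |logDefectDeriv Q r + r * logDefectDeriv₂ Q r| ≤ dominatingWeight Q r := by
  have hF := hQ.half_le_defect hM h0 h1
  have hF0 : 0 < defect Q r := by linarith
  have hs : 0 < 1 - r := by linarith
  have hQ1 := hQ.nonneg 1 r h0 h1
  have hQ2 := hQ.nonneg 2 r h0 h1
  have hQ3 := hQ.nonneg 3 r h0 h1
  have b1 := hQ.bound_one hM h0 h1
  have b2 := hQ.bound_two hM h0 h1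
  have e : logDefectDeriv Q r + r * logDefectDeriv₂ Q r =
      (defectDeriv Q r + r * defectDeriv₂ Q r) / defect Q r -
        r * (defectDeriv Q r / defect Q r) ^ 2 := by
    rw [logDefectDeriv, logDefectDeriv₂]; ring
  have hinv : (defect Q r)⁻¹ ≤ 2 := by
    rw [inv_le_comm₀ hF0 (by norm_num)]; linarith
  set P := Q 1 r + (1 - r) * Q 2 r with hP
  have hP0 : 0 ≤ P := by positivity
  have hd1 : |defectDeriv Q r| ≤ P := by
    rw [defectDeriv, abs_le]
    have : 0 ≤ (1 - r) * Q 2 r := by positivity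
    constructor <;> simp only [hP] <;> linarith
  have hd1' : (1 - r) * |defectDeriv Q r| ≤ 5 / 2 := by
    refine (mul_le_mul_of_nonneg_left hd1 hs.le).trans ?_
    rw [hP]; nlinarith
  have hd2 : |defectDeriv Q r + r * defectDeriv₂ Q r| ≤ P + 2 * Q 2 r + (1 - r) * Q 3 r := by
    have h2 : |defectDeriv₂ Q r| ≤ 2 * Q 2 r + (1 - r) * Q 3 r := by
      rw [defectDeriv₂, abs_le]
      have : 0 ≤ (1 - r) * Q 3 r := by positivity
      constructor <;> linarith
    refine (abs_add_le _ _).trans ?_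
    rw [abs_mul, abs_of_nonneg h0]
    have := mul_le_mul h1.le h2 (abs_nonneg _) zero_le_one
    linarith
  have t1 : |(defectDeriv Q r + r * defectDeriv₂ Q r) / defect Q r| ≤
      2 * (P + 2 * Q 2 r + (1 - r) * Q 3 r) := by
    rw [div_eq_mul_inv, abs_mul, abs_of_pos (inv_pos.2 hF0), mul_comm]
    exact mul_le_mul hinv hd2 (abs_nonneg _) (by norm_num)
  have t2 : (1 - r) * |r * (defectDeriv Q r / defect Q r) ^ 2| ≤ 10 * P := by
    rw [abs_mul, abs_of_nonneg h0, abs_pow, abs_div, abs_of_pos hF0, div_pow, div_eq_mul_inv,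
      ← inv_pow]
    have i2 : ((defect Q r)⁻¹) ^ 2 ≤ 4 := by
      have := pow_le_pow_left₀ (inv_pos.2 hF0).le hinv 2
      linarith
    calc (1 - r) * (r * (|defectDeriv Q r| ^ 2 * ((defect Q r)⁻¹) ^ 2))
        ≤ (1 - r) * (1 * (|defectDeriv Q r| ^ 2 * 4)) := by gcongr
      _ = 4 * (((1 - r) * |defectDeriv Q r|) * |defectDeriv Q r|) := by ring
      _ ≤ 4 * (5 / 2 * P) := by gcongr
      _ = 10 * P := by ring
  calc (1 - r) * |logDefectDeriv Q r + r * logDefectDeriv₂ Q r|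
      ≤ (1 - r) * (|(defectDeriv Q r + r * defectDeriv₂ Q r) / defect Q r| +
        |r * (defectDeriv Q r / defect Q r) ^ 2|) := by
        rw [e]; gcongr; exact abs_sub _ _
    _ ≤ (1 - r) * (2 * (P + 2 * Q 2 r + (1 - r) * Q 3 r)) + 10 * P := by
        rw [mul_add]; gcongr
    _ ≤ 2 * P + 4 * ((1 - r) * Q 2 r) + 2 * ((1 - r) ^ 2 * Q 3 r) + 10 * P := by
        have : (1 - r) * P ≤ P := mul_le_of_le_one_left hP0 (by linarith)
        nlinarith
    _ ≤ dominatingWeight Q r := by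
        have : 0 ≤ (1 - r) ^ 2 * Q 3 r := by positivity
        rw [dominatingWeight, hP]
        linarith

lemma sq_mul_abs_logDefect_laplacian_le (hQ : IsAbsolutelyMonotone Q)
    (hM : ∀ r, 0 ≤ r → r < 1 → Q 0 r ≤ 1 / 4) {r : ℝ} (h0 : 0 ≤ r) (h1 : r < 1) :
    (1 - r) ^ 2 * |logDefectDeriv Q r + r * logDefectDeriv₂ Q r| ≤ 18 ^ 2 := by
  have h := mul_le_mul_of_nonneg_left (hQ.abs_logDefect_laplacian_le hM h0 h1)
    (sub_pos.2 h1).le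
  have b1 := hQ.bound_one hM h0 h1
  have b2 := hQ.bound_two hM h0 h1
  have b3 := hQ.bound_three hM h0 h1
  have e : (1 - r) * dominatingWeight Q r =
      16 * ((1 - r) * Q 1 r + (1 - r) ^ 2 * Q 2 r + (1 - r) ^ 3 * Q 3 r) := by
    rw [dominatingWeight]; ring
  rw [e, ← mul_assoc, ← sq] at h
  linarith

lemma hasDerivAt_dominatingPotential (hQ : IsAbsolutelyMonotone Q) {r : ℝ} (h0 : 0 ≤ r)
    (h1 : r < 1) : HasDerivAt (dominatingPotential Q) (dominatingWeight Q r) r := by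
  have hs := (hasDerivAt_id r).const_sub 1
  have h := ((((hs.pow 2).mul (hQ.hasDerivAt' 2 h0 h1)).add
    ((hs.const_mul 3).mul (hQ.hasDerivAt' 1 h0 h1))).add
      ((hQ.hasDerivAt' 0 h0 h1).const_mul 4)).const_mul 16
  refine h.congr_deriv ?_
  simp [dominatingWeight]
  ring

lemma continuousOn_dominatingWeight (hQ : IsAbsolutelyMonotone Q) :
    ContinuousOn (dominatingWeight Q) (Set.Ico 0 1) := by
  have hc : ∀ j, ContinuousOn (Q j) (Set.Ico 0 1) := fun j r hr =>
    (hQ.hasDerivAt' j hr.1 hr.2).continuousAt.continuousWithinAt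
  have h1 := hc 1
  have h2 := hc 2
  have h3 := hc 3
  unfold dominatingWeight
  fun_prop

lemma dominatingPotential_nonneg (hQ : IsAbsolutelyMonotone Q) {r : ℝ} (h0 : 0 ≤ r)
    (h1 : r < 1) : 0 ≤ dominatingPotential Q r := by
  have hs : 0 ≤ 1 - r := by linarith
  have := hQ.nonneg 0 r h0 h1
  have := hQ.nonneg 1 r h0 h1
  have := hQ.nonneg 2 r h0 h1
  rw [dominatingPotential]
  positivity

lemma dominatingPotential_le (hQ : IsAbsolutelyMonotone Q)
    (hM : ∀ r, 0 ≤ r → r < 1 → Q 0 r ≤ 1 / 4) {r : ℝ} (h0 : 0 ≤ r) (h1 : r < 1) :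
    dominatingPotential Q r ≤ 72 := by
  have b0 := hM r h0 h1
  have b1 := hQ.bound_one hM h0 h1
  have b2 := hQ.bound_two hM h0 h1
  rw [dominatingPotential]
  linarith

end IsAbsolutelyMonotone

/-! ### Radial functions on the unit disk -/

namespace HasTwoContDerivsAt

variable {u u₁ u₂ v v₁ v₂ : ℝ → ℝ} {r : ℝ}

lemma sub (hu : HasTwoContDerivsAt u u₁ u₂ r) (hv : HasTwoContDerivsAt v v₁ v₂ r) :
    HasTwoContDerivsAt (fun s => u s - v s) (fun s => u₁ s - v₁ s) (fun s => u₂ s - v₂ s) r := by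
  filter_upwards [hu, hv] with s h1 h2
  exact ⟨h1.1.sub h2.1, h1.2.1.sub h2.2.1, h1.2.2.sub h2.2.2⟩

lemma contDiffAt (hu : HasTwoContDerivsAt u u₁ u₂ r) : ContDiffAt ℝ 2 u r := by
  obtain ⟨t, ht, hto, hrt⟩ := eventually_nhds_iff.1 hu
  have hd : ∀ s ∈ t, deriv u s = u₁ s := fun s hs => (ht s hs).1.deriv
  have hd₁ : ∀ s ∈ t, deriv u₁ s = u₂ s := fun s hs => (ht s hs).2.1.deriv
  have h1 : ContDiffOn ℝ 1 u₁ t := by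
    rw [show (1 : WithTop ℕ∞) = 0 + 1 by simp, contDiffOn_succ_iff_deriv_of_isOpen hto]
    refine ⟨fun s hs => (ht s hs).2.1.differentiableAt.differentiableWithinAt, by simp, ?_⟩
    rw [contDiffOn_zero]
    exact ContinuousOn.congr (fun s hs => (ht s hs).2.2.continuousWithinAt) hd₁
  have h2 : ContDiffOn ℝ 2 u t := by
    rw [show (2 : WithTop ℕ∞) = 1 + 1 by norm_num, contDiffOn_succ_iff_deriv_of_isOpen hto]
    exact ⟨fun s hs => (ht s hs).1.differentiableAt.differentiableWithinAt, by simp,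
      h1.congr hd⟩
  exact h2.contDiffAt (hto.mem_nhds hrt)

lemma contDiffAt_radial {z : ℂ} (hu : HasTwoContDerivsAt u u₁ u₂ (‖z‖ ^ 2)) :
    ContDiffAt ℝ 2 (fun w : ℂ => u (‖w‖ ^ 2)) z :=
  hu.contDiffAt.comp z (contDiff_norm_sq ℝ).contDiffAt

/-- For `Δ = ∂∂̄` one has `Δ (u(|z|²)) = (r u'(r))'` at `r = |z|²`. -/
lemma normalizedLaplacian_radial {z : ℂ} (hu : HasTwoContDerivsAt u u₁ u₂ (‖z‖ ^ 2)) :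
    normalizedLaplacian (fun w : ℂ => u (‖w‖ ^ 2)) z =
      u₁ (‖z‖ ^ 2) + ‖z‖ ^ 2 * u₂ (‖z‖ ^ 2) := by
  set L : ℂ →L[ℝ] ℂ →L[ℝ] ℝ :=
    (2 : ℝ) • (reCLM.smulRight reCLM + imCLM.smulRight imCLM) with hL
  have hn : ∀ w : ℂ, HasFDerivAt (fun w : ℂ => ‖w‖ ^ 2) (L w) w := by
    intro w
    refine (hasStrictFDerivAt_norm_sq w).hasFDerivAt.congr_fderiv ?_
    ext v
    simp [hL, Complex.inner]
    ring
  have hcont : ContinuousAt (fun w : ℂ => ‖w‖ ^ 2) z := by fun_prop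
  have hfd : fderiv ℝ (fun w : ℂ => u (‖w‖ ^ 2)) =ᶠ[𝓝 z] fun w => u₁ (‖w‖ ^ 2) • L w := by
    filter_upwards [hcont.eventually hu] with w hw
    exact (hw.1.comp_hasFDerivAt w (hn w)).fderiv
  have h2 : HasFDerivAt (fun w : ℂ => u₁ (‖w‖ ^ 2) • L w)
      (u₁ (‖z‖ ^ 2) • L + (u₂ (‖z‖ ^ 2) • L z).smulRight (L z)) z :=
    (hu.self_of_nhds.2.1.comp_hasFDerivAt z (hn z)).smul L.hasFDerivAt
  have hff := hfd.fderiv_eq.trans h2.fderiv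
  have hz : ‖z‖ ^ 2 = z.re ^ 2 + z.im ^ 2 := by
    rw [Complex.sq_norm, Complex.normSq_apply]; ring
  rw [normalizedLaplacian, InnerProductSpace.laplacian_eq_iteratedFDeriv_complexPlane]
  simp only [iteratedFDeriv_two_apply, hff]
  simp [hz, hL]
  ring

end HasTwoContDerivsAt

section RadialMeanValue

variable {φ φ₁ φ₂ : ℝ → ℝ}

lemma mul_deriv_monotoneOn
    (hφ : ∀ r ∈ Set.Ico (0 : ℝ) 1, HasTwoContDerivsAt φ φ₁ φ₂ r)
    (hpos : ∀ r ∈ Set.Ico (0 : ℝ) 1, 0 ≤ φ₁ r + r * φ₂ r) :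
    MonotoneOn (fun r => r * φ₁ r) (Set.Ico 0 1) := by
  have hd : ∀ r ∈ Set.Ico (0 : ℝ) 1, HasDerivAt (fun r => r * φ₁ r) (φ₁ r + r * φ₂ r) r := by
    intro r hr
    exact ((hasDerivAt_id r).mul (hφ r hr).self_of_nhds.2.1).congr_deriv (by simp)
  refine monotoneOn_of_hasDerivWithinAt_nonneg (f' := fun r => φ₁ r + r * φ₂ r) (convex_Ico 0 1)
    (fun r hr => (hd r hr).continuousAt.continuousWithinAt)
    (fun r hr => (hd r (interior_subset hr)).hasDerivWithinAt)
    (fun r hr => hpos r (interior_subset hr))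

lemma radial_monotoneOn
    (hφ : ∀ r ∈ Set.Ico (0 : ℝ) 1, HasTwoContDerivsAt φ φ₁ φ₂ r)
    (hpos : ∀ r ∈ Set.Ico (0 : ℝ) 1, 0 ≤ φ₁ r + r * φ₂ r) :
    MonotoneOn φ (Set.Ico 0 1) := by
  have hG := mul_deriv_monotoneOn hφ hpos
  refine monotoneOn_of_hasDerivWithinAt_nonneg (f' := φ₁) (convex_Ico 0 1)
    (fun r hr => (hφ r hr).self_of_nhds.1.continuousAt.continuousWithinAt)
    (fun r hr => (hφ r (interior_subset hr)).self_of_nhds.1.hasDerivWithinAt) (fun r hr => ?_)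
  rw [interior_Ico] at hr
  have := hG ⟨le_rfl, one_pos⟩ ⟨hr.1.le, hr.2⟩ hr.1.le
  simp only [zero_mul] at this
  exact (mul_nonneg_iff_of_pos_left hr.1).1 this

/-- A radial function with nonnegative Laplacian is a convex function of `log r`; this is the
inequality between its graph and the tangent at `r₀`. -/
lemma radial_tangent_le
    (hφ : ∀ r ∈ Set.Ico (0 : ℝ) 1, HasTwoContDerivsAt φ φ₁ φ₂ r)
    (hpos : ∀ r ∈ Set.Ico (0 : ℝ) 1, 0 ≤ φ₁ r + r * φ₂ r)
    {r₀ r : ℝ} (h₀ : r₀ ∈ Set.Ioo (0 : ℝ) 1) (h : r ∈ Set.Ioo (0 : ℝ) 1) :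
    φ r₀ + r₀ * φ₁ r₀ * (Real.log r - Real.log r₀) ≤ φ r := by
  have hG := mul_deriv_monotoneOn hφ hpos
  set D : ℝ → ℝ := fun s => φ s - r₀ * φ₁ r₀ * Real.log s with hD
  have hd : ∀ s ∈ Set.Ioo (0 : ℝ) 1, HasDerivAt D (φ₁ s - r₀ * φ₁ r₀ * s⁻¹) s := fun s hs =>
    (hφ s ⟨hs.1.le, hs.2⟩).self_of_nhds.1.sub ((Real.hasDerivAt_log hs.1.ne').const_mul _)
  have hsign : ∀ s ∈ Set.Ioo (0 : ℝ) 1,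
      φ₁ s - r₀ * φ₁ r₀ * s⁻¹ = (s * φ₁ s - r₀ * φ₁ r₀) * s⁻¹ := by
    intro s hs
    have := hs.1.ne'
    field_simp
  have key : D r₀ ≤ D r := by
    rcases le_total r₀ r with hle | hle
    · have hm : MonotoneOn D (Set.Ico r₀ 1) := by
        refine monotoneOn_of_hasDerivWithinAt_nonneg (f' := fun s => φ₁ s - r₀ * φ₁ r₀ * s⁻¹)
          (convex_Ico _ _)
          (fun s hs => (hd s ⟨h₀.1.trans_le hs.1, hs.2⟩).continuousAt.continuousWithinAt)
          (fun s hs => (hd s ⟨h₀.1.trans_le (interior_subset hs).1,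
            (interior_subset hs).2⟩).hasDerivWithinAt) (fun s hs => ?_)
        have hs' := interior_subset hs
        have hs0 : 0 < s := h₀.1.trans_le hs'.1
        rw [hsign s ⟨hs0, hs'.2⟩]
        have := hG ⟨h₀.1.le, h₀.2⟩ ⟨hs0.le, hs'.2⟩ hs'.1
        exact mul_nonneg (sub_nonneg.2 this) (inv_pos.2 hs0).le
      exact hm ⟨le_rfl, h₀.2⟩ ⟨hle, h.2⟩ hle
    · have hm : AntitoneOn D (Set.Ioc 0 r₀) := by
        refine antitoneOn_of_hasDerivWithinAt_nonpos (f' := fun s => φ₁ s - r₀ * φ₁ r₀ * s⁻¹)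
          (convex_Ioc _ _)
          (fun s hs => (hd s ⟨hs.1, hs.2.trans_lt h₀.2⟩).continuousAt.continuousWithinAt)
          (fun s hs => (hd s ⟨(interior_subset hs).1,
            (interior_subset hs).2.trans_lt h₀.2⟩).hasDerivWithinAt) (fun s hs => ?_)
        have hs' := interior_subset hs
        rw [hsign s ⟨hs'.1, hs'.2.trans_lt h₀.2⟩]
        have := hG ⟨hs'.1.le, hs'.2.trans_lt h₀.2⟩ ⟨h₀.1.le, h₀.2⟩ hs'.2
        exact mul_nonpos_of_nonpos_of_nonneg (sub_nonpos.2 this) (inv_pos.2 hs'.1).le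
      exact hm ⟨h.1, hle⟩ ⟨h₀.1, le_rfl⟩ hle
  simp only [hD] at key
  linarith

lemma log_norm_le_circleAverage {z : ℂ} {R : ℝ} (hR : 0 < R) (hz : z ≠ 0) :
    Real.log ‖z‖ ≤ Real.circleAverage (fun w : ℂ => Real.log ‖w‖) z R := by
  have h := circleAverage_log_norm_sub_const_eq_log_radius_add_posLog (c := z) (a := 0) hR.ne'
  simp only [sub_zero] at h
  rw [h]
  have h1 : Real.log (R⁻¹ * ‖z‖) ≤ Real.posLog (R⁻¹ * ‖z‖) := le_max_right _ _
  rw [Real.log_mul (inv_ne_zero hR.ne') (norm_ne_zero_iff.2 hz), Real.log_inv] at h1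
  linarith

/-- A radial function with nonnegative Laplacian is subharmonic: being an increasing convex function
of `log |z|`, it inherits the mean value inequality from `log |z|`. -/
lemma radial_isSubharmonicOn
    (hφ : ∀ r ∈ Set.Ico (0 : ℝ) 1, HasTwoContDerivsAt φ φ₁ φ₂ r)
    (hpos : ∀ r ∈ Set.Ico (0 : ℝ) 1, 0 ≤ φ₁ r + r * φ₂ r) :
    IsSubharmonicOn (fun z : ℂ => φ (‖z‖ ^ 2)) (Metric.ball 0 1) := by
  have hmem : ∀ w ∈ Metric.ball (0 : ℂ) 1, ‖w‖ ^ 2 ∈ Set.Ico (0 : ℝ) 1 := by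
    intro w hw
    exact ⟨by positivity, (sq_lt_one_iff₀ (norm_nonneg w)).2 (by simpa using hw)⟩
  have hcont : ContinuousOn (fun z : ℂ => φ (‖z‖ ^ 2)) (Metric.ball 0 1) := fun w hw =>
    (hφ _ (hmem w hw)).contDiffAt_radial.continuousAt.continuousWithinAt
  refine ⟨hcont.upperSemicontinuousOn, fun z R hR hsub => ?_⟩
  have hsph : Metric.sphere z R ⊆ Metric.ball 0 1 := Metric.sphere_subset_closedBall.trans hsub
  have hint : CircleIntegrable (fun z : ℂ => φ (‖z‖ ^ 2)) z R :=
    (hcont.mono hsph).circleIntegrable hR.le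
  refine ⟨hint, ?_⟩
  have hzb : z ∈ Metric.ball (0 : ℂ) 1 := hsub (Metric.mem_closedBall_self hR.le)
  rcases eq_or_ne z 0 with rfl | hz
  · refine (Real.circleAverage_const (φ (‖(0 : ℂ)‖ ^ 2)) (0 : ℂ) R).ge.trans
      (Real.circleAverage_mono (circleIntegrable_const _ _ _) hint fun w hw => ?_)
    rw [abs_of_pos hR] at hw
    have hw' := hmem w (hsph hw)
    exact radial_monotoneOn hφ hpos (hmem 0 hzb) hw' (by simp)
  · have hr₀ : ‖z‖ ^ 2 ∈ Set.Ioo (0 : ℝ) 1 := ⟨by positivity, (hmem z hzb).2⟩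
    set b : ℝ := ‖z‖ ^ 2 * φ₁ (‖z‖ ^ 2) with hb
    have hb0 : 0 ≤ b := by
      have := mul_deriv_monotoneOn hφ hpos ⟨le_rfl, one_pos⟩ (hmem z hzb) hr₀.1.le
      simpa using this
    have hlogint : CircleIntegrable (fun w : ℂ => Real.log ‖w‖) z R := by
      simpa using circleIntegrable_log_norm_sub_const (c := z) (a := 0) R
    have hlow : CircleIntegrable
        (fun w : ℂ => φ (‖z‖ ^ 2) - b * (2 * Real.log ‖z‖) + (2 * b) • Real.log ‖w‖) z R :=
      (circleIntegrable_const _ _ _).add (hlogint.const_fun_smul (a := 2 * b))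
    -- The tangent inequality may fail only where the circle meets the origin.
    have hmono : Real.circleAverage
        (fun w : ℂ => φ (‖z‖ ^ 2) - b * (2 * Real.log ‖z‖) + (2 * b) • Real.log ‖w‖) z R ≤
        Real.circleAverage (fun w : ℂ => φ (‖w‖ ^ 2)) z R := by
      rw [Real.circleAverage, Real.circleAverage]
      refine smul_le_smul_of_nonneg_left ?_ (by positivity)
      refine intervalIntegral.integral_mono_ae (by positivity) hlow hint ?_
      have hnull : volume (circleMap z R ⁻¹' {0}) = 0 :=
        ((Set.countable_singleton 0).preimage_circleMap z hR.ne').measure_zero _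
      filter_upwards [measure_eq_zero_iff_ae_notMem.1 hnull] with θ hθ
      have hne : circleMap z R θ ≠ 0 := hθ
      have hwb := hmem _ (hsph (circleMap_mem_sphere z hR.le θ))
      have hw : ‖circleMap z R θ‖ ^ 2 ∈ Set.Ioo (0 : ℝ) 1 := ⟨by positivity, hwb.2⟩
      have ht := radial_tangent_le hφ hpos hr₀ hw
      rw [Real.log_pow, Real.log_pow] at ht
      push_cast at ht
      simp only [smul_eq_mul]
      linarith
    refine le_trans ?_ hmono
    rw [Real.circleAverage_fun_add (circleIntegrable_const _ _ _)
      (hlogint.const_fun_smul (a := 2 * b)), Real.circleAverage_const, Real.circleAverage_fun_smul,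
      smul_eq_mul]
    have := mul_le_mul_of_nonneg_left (log_norm_le_circleAverage hR hz)
      (by positivity : 0 ≤ 2 * b)
    linarith

end RadialMeanValue

/-! ### The radial Poisson equation -/

/-- If `h = (r u')'` is nonpositive on `[0, 1/4]` and `(1 - r) |h|` is dominated by the derivative
of a bounded function `Φ`, so that `∫ (1 - r) |h| dr` is finite, then `(r φ')' = |h|` has a bounded
solution on `[0, 1)`. -/
lemma exists_bounded_radial_solution {u u₁ u₂ A Φ : ℝ → ℝ} {Mu MΦ : ℝ}
    (hu : ∀ r ∈ Set.Ico (0 : ℝ) 1, HasTwoContDerivsAt u u₁ u₂ r)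
    (huM : ∀ r ∈ Set.Ico (0 : ℝ) 1, |u r| ≤ Mu)
    (hneg : ∀ r ∈ Set.Icc (0 : ℝ) (1 / 4), u₁ r + r * u₂ r ≤ 0)
    (hA : ∀ r ∈ Set.Ico (0 : ℝ) 1, (1 - r) * |u₁ r + r * u₂ r| ≤ A r)
    (hΦ : ∀ r ∈ Set.Ico (0 : ℝ) 1, HasDerivAt Φ (A r) r)
    (hΦ0 : ∀ r ∈ Set.Ico (0 : ℝ) 1, 0 ≤ Φ r) (hΦM : ∀ r ∈ Set.Ico (0 : ℝ) 1, Φ r ≤ MΦ) :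
    ∃ φ φ₁ φ₂ : ℝ → ℝ, (∀ r ∈ Set.Ico (0 : ℝ) 1, HasTwoContDerivsAt φ φ₁ φ₂ r) ∧
      (∀ r ∈ Set.Ico (0 : ℝ) 1, φ₁ r + r * φ₂ r = |u₁ r + r * u₂ r|) ∧
      ∀ r ∈ Set.Ico (0 : ℝ) 1, |φ r| ≤ 8 * MΦ + Mu := by
  set h : ℝ → ℝ := fun r => u₁ r + r * u₂ r with hh
  -- `|h| = k - h` for `k = 2 h⁺`; as `k` vanishes near the origin, `k` is the Laplacian of
  -- a function that is twice continuously differentiable in `r`, also at `r = 0`.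
  set k : ℝ → ℝ := fun r => 2 * max (h (max r (1 / 4))) 0 with hk
  have hhc : ContinuousOn h (Set.Ico 0 1) := fun r hr =>
    ((hu r hr).self_of_nhds.2.1.continuousAt.add
      (continuousAt_id.mul (hu r hr).self_of_nhds.2.2)).continuousWithinAt
  have hkc : ContinuousOn k (Set.Iio 1) := by
    refine continuousOn_const.mul (ContinuousOn.sup (hhc.comp (by fun_prop) fun r hr => ?_)
      continuousOn_const)
    exact ⟨le_max_of_le_right (by norm_num), max_lt hr (by norm_num)⟩
  have hk0 : ∀ r, 0 ≤ k r := fun r => mul_nonneg zero_le_two (le_max_right _ _)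
  have hkz : ∀ r ≤ 1 / 4, k r = 0 := by
    intro r hr
    have hq : h (1 / 4) ≤ 0 := hneg (1 / 4) ⟨by norm_num, le_rfl⟩
    simp only [hk, max_eq_right hr, max_eq_right hq, mul_zero]
  have hkh : ∀ r ∈ Set.Ico (0 : ℝ) 1, k r - h r = |h r| := by
    intro r hr
    rcases le_total r (1 / 4) with hle | hle
    · rw [hkz r hle, abs_of_nonpos (hneg r ⟨hr.1, hle⟩), zero_sub]
    · simp only [hk, max_eq_left hle]
      rcases le_total 0 (h r) with h0 | h0
      · rw [max_eq_left h0, abs_of_nonneg h0]; ring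
      · rw [max_eq_right h0, abs_of_nonpos h0]; ring
  have hprim : ∀ f : ℝ → ℝ, ContinuousOn f (Set.Iio 1) → ∀ r < 1,
      HasDerivAt (fun s => ∫ t in (1 / 4 : ℝ)..s, f t) (f r) r := by
    intro f hf r hr
    have hsub : Set.uIcc (1 / 4) r ⊆ Set.Iio 1 := fun t ht =>
      ht.2.trans_lt (max_lt (by norm_num) hr)
    exact intervalIntegral.integral_hasDerivAt_right (hf.mono hsub).intervalIntegrable
      (hf.stronglyMeasurableAtFilter isOpen_Iio r hr) (hf.continuousAt (Iio_mem_nhds hr))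
  set H : ℝ → ℝ := fun s => ∫ t in (1 / 4 : ℝ)..s, k t with hH
  have hHd : ∀ r < 1, HasDerivAt H (k r) r := hprim k hkc
  have hHz : ∀ r ≤ 1 / 4, H r = 0 := by
    intro r hr
    refine (intervalIntegral.integral_congr (g := fun _ => 0) fun t ht => ?_).trans (by simp)
    rw [Set.uIcc_of_ge hr] at ht
    exact hkz t ht.2
  have hH0 : ∀ r, 0 ≤ H r := by
    intro r
    rcases le_total r (1 / 4) with hle | hle
    · exact (hHz r hle).ge
    · exact intervalIntegral.integral_nonneg hle fun t _ => hk0 t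
  set m : ℝ → ℝ := fun r => H r / r with hm
  set m' : ℝ → ℝ := fun r => (k r * r - H r) / r ^ 2 with hm'
  have hmz : ∀ r < 1 / 4, m =ᶠ[𝓝 r] fun _ => 0 := by
    intro r hr
    filter_upwards [Iio_mem_nhds hr] with s hs
    simp [hm, hHz s (le_of_lt hs)]
  have hm'z : ∀ r < 1 / 4, m' =ᶠ[𝓝 r] fun _ => 0 := by
    intro r hr
    filter_upwards [Iio_mem_nhds hr] with s hs
    simp [hm', hHz s (le_of_lt hs), hkz s (le_of_lt hs)]
  have hmd : ∀ r < 1, HasDerivAt m (m' r) r := by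
    intro r hr
    rcases lt_or_ge r (1 / 4) with hlt | hge
    · rw [(hm'z r hlt).self_of_nhds]
      exact (hasDerivAt_const r (0 : ℝ)).congr_of_eventuallyEq (hmz r hlt)
    · have hr0 : r ≠ 0 := by linarith
      refine ((hHd r hr).div (hasDerivAt_id r) hr0).congr_deriv ?_
      simp [hm']
  have hm'c : ∀ r < 1, ContinuousAt m' r := by
    intro r hr
    rcases lt_or_ge r (1 / 4) with hlt | hge
    · exact continuousAt_const.congr (hm'z r hlt).symm
    · have hr0 : r ≠ 0 := by linarith
      exact (((hkc.continuousAt (Iio_mem_nhds hr)).mul continuousAt_id).sub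
        (hHd r hr).continuousAt).div (continuousAt_id.pow 2) (pow_ne_zero 2 hr0)
  set ψ : ℝ → ℝ := fun s => ∫ t in (1 / 4 : ℝ)..s, m t with hψ
  have hψd : ∀ r < 1, HasDerivAt ψ (m r) r :=
    hprim m fun r hr => (hmd r hr).continuousAt.continuousWithinAt
  have hψz : ∀ r ≤ 1 / 4, ψ r = 0 := by
    intro r hr
    refine (intervalIntegral.integral_congr (g := fun _ => 0) fun t ht => ?_).trans (by simp)
    rw [Set.uIcc_of_ge hr] at ht
    simp [hm, hHz t ht.2]
  have hψ0 : ∀ r, 0 ≤ ψ r := by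
    intro r
    rcases le_total r (1 / 4) with hle | hle
    · exact (hψz r hle).ge
    · exact intervalIntegral.integral_nonneg hle fun t ht =>
        div_nonneg (hH0 t) ((by norm_num : (0 : ℝ) ≤ 1 / 4).trans ht.1)
  have hψM : ∀ r ∈ Set.Ico (0 : ℝ) 1, ψ r ≤ 8 * MΦ := by
    intro r hr
    have hMΦ : 0 ≤ MΦ := (hΦ0 r hr).trans (hΦM r hr)
    rcases le_total r (1 / 4) with hle | hle
    · rw [hψz r hle]; positivity
    -- An integration by parts in the guise of a monotone quantity.
    have hanti : AntitoneOn (fun s => 1 / 4 * ψ s + (1 - s) * H s - 2 * Φ s)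
        (Set.Ico (1 / 4) 1) := by
      have hd : ∀ s ∈ Set.Ico (1 / 4 : ℝ) 1,
          HasDerivAt (fun s => 1 / 4 * ψ s + (1 - s) * H s - 2 * Φ s)
            (1 / 4 * m s + (-1 * H s + (1 - s) * k s) - 2 * A s) s := fun s hs =>
        (((hψd s hs.2).const_mul _).add (((hasDerivAt_id s).const_sub 1).mul (hHd s hs.2))).sub
          ((hΦ s ⟨by linarith [hs.1], hs.2⟩).const_mul 2)
      refine antitoneOn_of_hasDerivWithinAt_nonpos (convex_Ico _ _)
        (fun s hs => (hd s hs).continuousAt.continuousWithinAt)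
        (fun s hs => (hd s (interior_subset hs)).hasDerivWithinAt) (fun s hs => ?_)
      have hs' := interior_subset hs
      have hs0 : 0 < s := by linarith [hs'.1]
      have hsI : s ∈ Set.Ico (0 : ℝ) 1 := ⟨hs0.le, hs'.2⟩
      have e1 : 1 / 4 * m s ≤ H s := by
        rw [hm, ← mul_div_assoc, div_le_iff₀ hs0]
        nlinarith [hH0 s, hs'.1]
      have e2 : k s ≤ 2 * |h s| := by
        linarith [hkh s hsI, le_abs_self (h s)]
      have e3 := mul_le_mul_of_nonneg_left e2 (sub_pos.2 hs'.2).le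
      have e4 := hA s hsI
      linarith
    have hkey := hanti ⟨le_rfl, by norm_num⟩ ⟨hle, hr.2⟩ hle
    simp only [hψz _ le_rfl, hHz _ le_rfl] at hkey
    have e1 := hΦ0 (1 / 4) ⟨by norm_num, by norm_num⟩
    have e2 := hΦM r hr
    have e3 := mul_nonneg (sub_pos.2 hr.2).le (hH0 r)
    linarith
  refine ⟨fun r => ψ r - u r, fun r => m r - u₁ r, fun r => m' r - u₂ r, fun r hr => ?_,
    fun r hr => ?_, fun r hr => ?_⟩
  · refine HasTwoContDerivsAt.sub ?_ (hu r hr)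
    filter_upwards [Iio_mem_nhds hr.2] with s hs
    exact ⟨hψd s hs, hmd s hs, hm'c s hs⟩
  · rw [← hkh r hr]
    rcases hr.1.eq_or_lt with rfl | hr0
    · simp [hm, hkz 0 (by norm_num), hh]
    · simp only [hm, hm', hh]
      have := hr0.ne'
      field_simp
      ring
  · have h1 := abs_le.1 (huM r hr)
    rw [abs_le]
    have h2 := hψ0 r
    have h3 := hψM r hr
    constructor <;> linarith

/-! ### Carleson measures with radial density -/

/-- The arguments of the points of a Carleson window of angle `ℓ` lie in three intervals of
length `ℓ`. -/
lemma exists_arg_mem_of_mem_carlesonWindow (a ℓ : ℝ) (hℓ : ℓ ≤ 2 * Real.pi) :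
    ∃ b : ℝ, ∀ z ∈ carlesonWindow a ℓ, Complex.arg z ∈ Set.Icc b (b + ℓ) ∪
      (Set.Icc (b - 2 * Real.pi) (b - 2 * Real.pi + ℓ) ∪
        Set.Icc (b + 2 * Real.pi) (b + 2 * Real.pi + ℓ)) := by
  have hπ := Real.pi_pos
  obtain ⟨n, hn, -⟩ := existsUnique_sub_zsmul_mem_Ico Real.two_pi_pos a (-Real.pi)
  refine ⟨a - n • (2 * Real.pi), fun z hz => ?_⟩
  obtain ⟨-, ⟨θ, hθ, hexp⟩, -⟩ := hz
  rw [zsmul_eq_mul] at hn ⊢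
  have hz0 : z ≠ 0 := by
    rintro rfl
    simp at hexp
  have hpolar : z / (‖z‖ : ℂ) = Complex.exp (Complex.arg z * Complex.I) := by
    have h := Complex.norm_mul_exp_arg_mul_I z
    rw [div_eq_iff (by simpa using hz0), mul_comm]
    exact h.symm
  rw [hpolar, Complex.exp_eq_exp_iff_exists_int] at hexp
  obtain ⟨k, hk⟩ := hexp
  have hθk : θ = Complex.arg z + k * (2 * Real.pi) := by
    have h1 : (θ : ℂ) = Complex.arg z + k * (2 * Real.pi) := by
      have hI := Complex.I_ne_zero
      apply mul_right_cancel₀ hI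
      rw [hk]; ring
    exact_mod_cast h1
  have hl := Complex.neg_pi_lt_arg z
  have hu := Complex.arg_le_pi z
  have hj : k - n = 0 ∨ k - n = 1 ∨ k - n = -1 := by
    have h1 : ((k - n : ℤ) : ℝ) < 2 := by
      push_cast
      by_contra hcon
      have := mul_le_mul_of_nonneg_right (not_lt.1 hcon) Real.two_pi_pos.le
      linarith [hθ.2, hn.2]
    have h2 : -2 < ((k - n : ℤ) : ℝ) := by
      push_cast
      by_contra hcon
      have := mul_le_mul_of_nonneg_right (not_lt.1 hcon) Real.two_pi_pos.le
      linarith [hθ.1, hn.1]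
    have h1' : k - n < 2 := by exact_mod_cast h1
    have h2' : -2 < k - n := by exact_mod_cast h2
    omega
  -- The case `k - n = -1` occurs only for `arg z = π`, which the principal argument attains.
  rcases hj with hj | hj | hj
  · have hkn : (k : ℝ) = n := by exact_mod_cast (by omega : k = n)
    rw [hkn] at hθk
    left
    constructor <;> linarith [hθ.1, hθ.2]
  · have hkn : (k : ℝ) = n + 1 := by exact_mod_cast (by omega : k = n + 1)
    rw [hkn] at hθk
    right; left
    constructor <;> linarith [hθ.1, hθ.2]
  · have hkn : (k : ℝ) = n - 1 := by exact_mod_cast (by omega : k = n - 1)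
    rw [hkn] at hθk
    right; right
    constructor <;> linarith [hθ.1, hθ.2]

/-- The integral of a nonnegative derivative `A = Φ'` over `(0, 1)` is at most the supremum of `Φ`,
without any regularity at `1`. -/
lemma setLIntegral_Ioo_deriv_le {A Φ : ℝ → ℝ} {M : ℝ}
    (hA0 : ∀ r ∈ Set.Ico (0 : ℝ) 1, 0 ≤ A r) (hAc : ContinuousOn A (Set.Ico 0 1))
    (hΦ : ∀ r ∈ Set.Ico (0 : ℝ) 1, HasDerivAt Φ (A r) r)
    (hΦ0 : 0 ≤ Φ 0) (hΦM : ∀ r ∈ Set.Ico (0 : ℝ) 1, Φ r ≤ M) :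
    ∫⁻ r in Set.Ioo (0 : ℝ) 1, ENNReal.ofReal (A r) ≤ ENNReal.ofReal M := by
  set b : ℕ → ℝ := fun n => 1 - 1 / ((n : ℝ) + 1) with hb
  have hb0 : ∀ n, 0 ≤ b n := fun n => by
    have : 1 / ((n : ℝ) + 1) ≤ 1 := by
      rw [div_le_one (by positivity)]; linarith [(Nat.cast_nonneg n : (0 : ℝ) ≤ n)]
    simp only [hb]; linarith
  have hb1 : ∀ n, b n < 1 := fun n => by
    have : 0 < 1 / ((n : ℝ) + 1) := by positivity
    simp only [hb]; linarith
  have hmono : Monotone fun n => Set.Ioc 0 (b n) := fun i j hij =>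
    Set.Ioc_subset_Ioc_right (sub_le_sub_left (one_div_le_one_div_of_le (by positivity)
      (by gcongr)) 1)
  have hsub : Set.Ioo (0 : ℝ) 1 ⊆ ⋃ n, Set.Ioc 0 (b n) := by
    intro r hr
    obtain ⟨n, hn⟩ := exists_nat_one_div_lt (sub_pos.2 hr.2)
    exact Set.mem_iUnion.2 ⟨n, hr.1, by simp only [hb]; linarith⟩
  refine (lintegral_mono_set hsub).trans ?_
  rw [setLIntegral_iUnion_of_directed _ hmono.directed_le]
  refine iSup_le fun n => ?_
  have hc : ContinuousOn A (Set.uIcc 0 (b n)) := by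
    rw [Set.uIcc_of_le (hb0 n)]
    exact hAc.mono (Set.Icc_subset_Ico_right (hb1 n))
  have hint := hc.intervalIntegrable (μ := volume)
  rw [intervalIntegrable_iff_integrableOn_Ioc_of_le (hb0 n)] at hint
  rw [← ofReal_integral_eq_lintegral_ofReal hint]
  · refine ENNReal.ofReal_le_ofReal ?_
    rw [← intervalIntegral.integral_of_le (hb0 n),
      intervalIntegral.integral_eq_sub_of_hasDerivAt (f := Φ) (fun r hr => ?_)
        hc.intervalIntegrable]
    · linarith [hΦM (b n) ⟨hb0 n, hb1 n⟩]
    · rw [Set.uIcc_of_le (hb0 n)] at hr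
      exact hΦ r ⟨hr.1, hr.2.trans_lt (hb1 n)⟩
  · filter_upwards [ae_restrict_mem measurableSet_Ioc] with r hr
    exact hA0 r ⟨hr.1.le, hr.2.trans_lt (hb1 n)⟩

/-- A density dominated by a radial function `A(|z|²)` with integrable `A` gives a Carleson
measure. -/
lemma isCarlesonMeasure_of_le_radial {g : ℂ → ℝ} {A Φ : ℝ → ℝ} {M : ℝ} (hM : 0 < M)
    (hg : ∀ z ∈ Metric.ball (0 : ℂ) 1, g z ≤ A (‖z‖ ^ 2))
    (hA0 : ∀ r ∈ Set.Ico (0 : ℝ) 1, 0 ≤ A r) (hAc : ContinuousOn A (Set.Ico 0 1))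
    (hΦ : ∀ r ∈ Set.Ico (0 : ℝ) 1, HasDerivAt Φ (A r) r)
    (hΦ0 : 0 ≤ Φ 0) (hΦM : ∀ r ∈ Set.Ico (0 : ℝ) 1, Φ r ≤ M) :
    IsCarlesonMeasure (diskMeasure g) := by
  have hπ := Real.pi_pos
  -- The radial integral is at most `M / 2`, and the angular one at most `3 ℓ`.
  refine ⟨M / 2 * 3 * (2 * Real.pi), by positivity, fun a ℓ hℓ0 hℓ => ?_⟩
  obtain ⟨b, hb⟩ := exists_arg_mem_of_mem_carlesonWindow a ℓ hℓ
  set J : Set ℝ := Set.Icc b (b + ℓ) ∪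
      (Set.Icc (b - 2 * Real.pi) (b - 2 * Real.pi + ℓ) ∪
        Set.Icc (b + 2 * Real.pi) (b + 2 * Real.pi + ℓ)) with hJ
  have hJm : MeasurableSet J := measurableSet_Icc.union (measurableSet_Icc.union measurableSet_Icc)
  have hJv : volume J ≤ ENNReal.ofReal (3 * ℓ) := by
    have hI : ∀ c : ℝ, volume (Set.Icc c (c + ℓ)) = ENNReal.ofReal ℓ := fun c => by simp
    calc volume J ≤ ENNReal.ofReal ℓ + (ENNReal.ofReal ℓ + ENNReal.ofReal ℓ) := by
          refine (measure_union_le _ _).trans (add_le_add (hI _).le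
            ((measure_union_le _ _).trans (add_le_add (hI _).le (hI _).le)))
      _ = ENNReal.ofReal (3 * ℓ) := by
          rw [← ENNReal.ofReal_add hℓ0.le hℓ0.le, ← ENNReal.ofReal_add hℓ0.le (by positivity)]
          congr 1; ring
  set B : ℝ → ENNReal := (Set.Ioo (0 : ℝ) 1).indicator
    (fun ρ => ENNReal.ofReal (ρ * A (ρ ^ 2))) with hB
  have hsq : ∀ ρ ∈ Set.Ico (0 : ℝ) 1, ρ ^ 2 ∈ Set.Ico (0 : ℝ) 1 := fun ρ hρ =>
    ⟨by positivity, (sq_lt_one_iff₀ hρ.1).2 hρ.2⟩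
  have hBc : ContinuousOn (fun ρ => ρ * A (ρ ^ 2)) (Set.Ico 0 1) :=
    continuousOn_id.mul (hAc.comp (by fun_prop) hsq)
  have hBint : ∫⁻ ρ, B ρ ≤ ENNReal.ofReal (M / 2) := by
    rw [hB, lintegral_indicator measurableSet_Ioo]
    refine setLIntegral_Ioo_deriv_le (Φ := fun ρ => Φ (ρ ^ 2) / 2)
      (fun ρ hρ => mul_nonneg hρ.1 (hA0 _ (hsq ρ hρ))) hBc (fun ρ hρ => ?_)
      (by simpa using div_nonneg hΦ0 zero_le_two)
      (fun ρ hρ => by linarith [hΦM _ (hsq ρ hρ)])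
    refine (((hΦ _ (hsq ρ hρ)).comp (h := fun ρ => ρ ^ 2) ρ
      (hasDerivAt_pow 2 ρ)).div_const 2).congr_deriv ?_
    push_cast
    ring
  have hBm : AEMeasurable B := by
    rw [hB, aemeasurable_indicator_iff measurableSet_Ioo]
    exact ((hBc.mono Set.Ioo_subset_Ico_self).aemeasurable measurableSet_Ioo).ennreal_ofReal
  have hle : diskMeasure g (carlesonWindow a ℓ) ≤
      ∫⁻ z : ℂ, (Metric.ball (0 : ℂ) 1 ∩ Complex.arg ⁻¹' J).indicator
        (fun z => ENNReal.ofReal (A (‖z‖ ^ 2))) z := by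
    have hmeas : MeasurableSet (Complex.arg ⁻¹' J) := Complex.measurable_arg hJm
    calc diskMeasure g (carlesonWindow a ℓ) ≤ diskMeasure g (Complex.arg ⁻¹' J) :=
          measure_mono fun z hz => hb z hz
      _ = ∫⁻ z in Metric.ball (0 : ℂ) 1 ∩ Complex.arg ⁻¹' J, ENNReal.ofReal (g z) := by
          rw [diskMeasure, withDensity_apply _ hmeas, Measure.restrict_restrict hmeas,
            Set.inter_comm]
      _ ≤ ∫⁻ z in Metric.ball (0 : ℂ) 1 ∩ Complex.arg ⁻¹' J, ENNReal.ofReal (A (‖z‖ ^ 2)) :=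
          setLIntegral_mono' (measurableSet_ball.inter hmeas) fun z hz =>
            ENNReal.ofReal_le_ofReal (hg z hz.1)
      _ = _ := (lintegral_indicator (measurableSet_ball.inter hmeas) _).symm
  refine hle.trans ?_
  rw [← Complex.lintegral_comp_polarCoord_symm]
  calc _ ≤ ∫⁻ p : ℝ × ℝ in polarCoord.target, B p.1 * J.indicator 1 p.2 := by
        refine setLIntegral_mono' polarCoord.open_target.measurableSet fun p hp => ?_
        have hp1 : 0 < p.1 := hp.1
        have hnorm : ‖Complex.polarCoord.symm p‖ = p.1 := by
          rw [Complex.norm_polarCoord_symm, abs_of_pos hp1]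
        have harg : Complex.arg (Complex.polarCoord.symm p) = p.2 := by
          rw [Complex.polarCoord_symm_apply]
          push_cast
          exact Complex.arg_mul_cos_add_sin_mul_I hp1 ⟨hp.2.1, hp.2.2.le⟩
        by_cases hmem : Complex.polarCoord.symm p ∈ Metric.ball (0 : ℂ) 1 ∩ Complex.arg ⁻¹' J
        · have h1 : p.1 < 1 := hnorm ▸ mem_ball_zero_iff.1 hmem.1
          have h2 : p.2 ∈ J := by rw [← harg]; exact hmem.2
          rw [Set.indicator_of_mem hmem, hnorm, hB, Set.indicator_of_mem (show p.1 ∈ Set.Ioo 0 1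
            from ⟨hp1, h1⟩), Set.indicator_of_mem h2, ENNReal.ofReal_mul hp1.le]
          simp
        · rw [Set.indicator_of_notMem hmem, smul_zero]
          exact zero_le
    _ ≤ ∫⁻ p : ℝ × ℝ, B p.1 * J.indicator 1 p.2 := setLIntegral_le_lintegral _ _
    _ = (∫⁻ ρ, B ρ) * ∫⁻ θ, J.indicator 1 θ := by
        rw [Measure.volume_eq_prod]
        exact lintegral_prod_mul hBm ((measurable_one.indicator hJm).aemeasurable)
    _ ≤ ENNReal.ofReal (M / 2) * ENNReal.ofReal (3 * ℓ) := by
        rw [lintegral_indicator_one hJm]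
        gcongr
    _ = ENNReal.ofReal (M / 2 * 3 * (2 * Real.pi) * (ℓ / (2 * Real.pi))) := by
        rw [← ENNReal.ofReal_mul (by positivity)]
        congr 1
        field_simp

/-! ### Monomials and coefficients in `H²_w` -/

section WeightedHardy

variable {w : HardyWeight}

lemma weightedHardy_ext {f g : weightedHardy w}
    (h : ∀ n, PowerSeries.coeff n (f : ℂ⟦X⟧) = PowerSeries.coeff n (g : ℂ⟦X⟧)) : f = g :=
  Subtype.ext (PowerSeries.ext h)

/-- The monomial `zⁿ` as an element of `H²_w`. -/
noncomputable def hardyMonomial (w : HardyWeight) (n : ℕ) : weightedHardy w :=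
  ⟨PowerSeries.X ^ n, summable_of_hasFiniteSupport ((Set.finite_singleton n).subset fun m hm => by
    by_contra h
    exact hm (by simp [PowerSeries.coeff_X_pow, show m ≠ n from h]))⟩

lemma coeff_hardyMonomial (n m : ℕ) :
    PowerSeries.coeff m (hardyMonomial w n : ℂ⟦X⟧) = if m = n then 1 else 0 :=
  PowerSeries.coeff_X_pow m n

lemma inner_hardyMonomial (n : ℕ) (f : weightedHardy w) :
    ⟪hardyMonomial w n, f⟫ = (w n : ℂ) * PowerSeries.coeff n (f : ℂ⟦X⟧) := by
  have h : weightedHardyToLp w (hardyMonomial w n) = lp.single 2 n (Real.sqrt (w n) : ℂ) := by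
    ext m
    rw [weightedHardyToLp_apply, coeff_hardyMonomial, lp.single_apply]
    by_cases hm : m = n
    · subst hm; simp
    · simp [hm]
  change ⟪weightedHardyToLp w (hardyMonomial w n), weightedHardyToLp w f⟫ = _
  rw [h, lp.inner_single_left, weightedHardyToLp_apply]
  simp only [RCLike.inner_apply, Complex.conj_ofReal]
  have := Real.mul_self_sqrt (w.pos n).le
  rw [mul_right_comm, ← Complex.ofReal_mul, this]

lemma norm_hardyMonomial_sq (n : ℕ) : ‖hardyMonomial w n‖ ^ 2 = w n := by
  have h := norm_sq_eq_re_inner (𝕜 := ℂ) (hardyMonomial w n)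
  rw [inner_hardyMonomial, coeff_hardyMonomial] at h
  simpa using h

/-- The `n`-th coefficient as a continuous linear functional on `H²_w`. -/
noncomputable def hardyCoeff (w : HardyWeight) (n : ℕ) : weightedHardy w →L[ℂ] ℂ :=
  (w n : ℂ)⁻¹ • innerSL ℂ (hardyMonomial w n)

lemma HardyWeight.ofReal_ne_zero (w : HardyWeight) (n : ℕ) : (w n : ℂ) ≠ 0 :=
  Complex.ofReal_ne_zero.2 (w.pos n).ne'

lemma hardyCoeff_apply (n : ℕ) (f : weightedHardy w) :
    hardyCoeff w n f = PowerSeries.coeff n (f : ℂ⟦X⟧) := by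
  simp [hardyCoeff, inner_hardyMonomial, w.ofReal_ne_zero n]

/-! ### The forward shift -/

lemma hasSum_X_mul (f g : weightedHardy w) (h : (g : ℂ⟦X⟧) = PowerSeries.X * (f : ℂ⟦X⟧)) :
    HasSum (fun n => ‖PowerSeries.coeff n (f : ℂ⟦X⟧)‖ ^ 2 * w (n + 1)) (‖g‖ ^ 2) := by
  have h1 := (hasSum_nat_add_iff' 1).2 (weightedHardy_hasSum_norm_sq w g)
  simpa [h, PowerSeries.coeff_succ_X_mul] using h1

/-- The forward shift `f ↦ z f` on `H²_w`, for weights with bounded quotients `wₙ₊₁ / wₙ`. -/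
noncomputable def hardyForwardShift (w : HardyWeight) {C : ℝ} (hC : 0 ≤ C)
    (hw : ∀ n, w (n + 1) ≤ C ^ 2 * w n) : weightedHardy w →L[ℂ] weightedHardy w :=
  LinearMap.mkContinuous
    { toFun := fun f => ⟨PowerSeries.X * (f : ℂ⟦X⟧), by
        change Summable _
        rw [← summable_nat_add_iff 1]
        simp only [PowerSeries.coeff_succ_X_mul]
        refine Summable.of_nonneg_of_le (fun n => mul_nonneg (sq_nonneg _) (w.pos _).le)
          (fun n => ?_) (Summable.mul_left (C ^ 2) f.2)
        rw [mul_left_comm]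
        exact mul_le_mul_of_nonneg_left (hw n) (sq_nonneg _)⟩
      map_add' := fun f g => Subtype.ext (mul_add _ _ _)
      map_smul' := fun c f => Subtype.ext (mul_smul_comm _ _ _) }
    C (by
      intro f
      refine le_of_sq_le_sq ?_ (mul_nonneg hC (norm_nonneg f))
      rw [mul_pow]
      refine hasSum_le (fun n => ?_) (hasSum_X_mul f _ rfl)
        ((weightedHardy_hasSum_norm_sq w f).mul_left (C ^ 2))
      rw [mul_left_comm]
      exact mul_le_mul_of_nonneg_left (hw n) (sq_nonneg _))

lemma norm_hardyForwardShift_le {C : ℝ} (hC : 0 ≤ C) (hw : ∀ n, w (n + 1) ≤ C ^ 2 * w n)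
    (f : weightedHardy w) : ‖hardyForwardShift w hC hw f‖ ≤ C * ‖f‖ :=
  (ContinuousLinearMap.le_opNorm _ f).trans
    (mul_le_mul_of_nonneg_right (LinearMap.mkContinuous_norm_le _ hC _) (norm_nonneg f))

lemma le_norm_hardyForwardShift {C : ℝ} (hC : 0 ≤ C) (hw : ∀ n, w (n + 1) ≤ C ^ 2 * w n)
    (hw' : ∀ n, w n ≤ C ^ 2 * w (n + 1)) (f : weightedHardy w) :
    ‖f‖ ≤ C * ‖hardyForwardShift w hC hw f‖ := by
  refine le_of_sq_le_sq ?_ (mul_nonneg hC (norm_nonneg _))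
  rw [mul_pow]
  refine hasSum_le (fun n => ?_) (weightedHardy_hasSum_norm_sq w f)
    ((hasSum_X_mul f _ rfl).mul_left (C ^ 2))
  rw [mul_left_comm]
  exact mul_le_mul_of_nonneg_left (hw' n) (sq_nonneg _)

lemma isBackwardShift_adjoint_hardyForwardShift {C : ℝ} (hC : 0 ≤ C)
    (hw : ∀ n, w (n + 1) ≤ C ^ 2 * w n) :
    IsBackwardShift (ContinuousLinearMap.adjoint (hardyForwardShift w hC hw)) := by
  intro f
  rw [ContinuousLinearMap.adjoint_adjoint]
  rfl

lemma coeff_hardyBackwardShift (f : HardySpace) (n : ℕ) :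
    PowerSeries.coeff n (hardyBackwardShift f : ℂ⟦X⟧) = PowerSeries.coeff (n + 1) (f : ℂ⟦X⟧) :=
  PowerSeries.coeff_mk n fun n => PowerSeries.coeff (n + 1) (f : ℂ⟦X⟧)

lemma isBackwardShift_hardyBackwardShift : IsBackwardShift hardyBackwardShift := by
  intro f
  ext n
  have hone : ∀ m, (HardyWeight.one m : ℂ) = 1 := fun m => by simp [HardyWeight.one]
  have h := inner_hardyMonomial n (ContinuousLinearMap.adjoint hardyBackwardShift f)
  rw [hone, one_mul, ContinuousLinearMap.adjoint_inner_right] at h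
  rw [← h]
  cases n with
  | zero =>
    have h0 : hardyBackwardShift (hardyMonomial _ 0) = 0 := by
      refine weightedHardy_ext fun m => ?_
      simp [coeff_hardyBackwardShift, coeff_hardyMonomial]
    simp [h0]
  | succ n =>
    have h1 : hardyBackwardShift (hardyMonomial _ (n + 1)) = hardyMonomial _ n := by
      refine weightedHardy_ext fun m => ?_
      simp [coeff_hardyBackwardShift, coeff_hardyMonomial]
    rw [h1, inner_hardyMonomial, hone, one_mul, PowerSeries.coeff_succ_X_mul]

/-! ### Eigenvectors of backward shifts -/

variable {T : weightedHardy w →L[ℂ] weightedHardy w}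

namespace IsBackwardShift

lemma adjoint_hardyMonomial (hT : IsBackwardShift T) (n : ℕ) :
    ContinuousLinearMap.adjoint T (hardyMonomial w n) = hardyMonomial w (n + 1) :=
  Subtype.ext ((hT _).trans (pow_succ' _ _).symm)

lemma mul_coeff_apply (hT : IsBackwardShift T) (f : weightedHardy w) (n : ℕ) :
    (w n : ℂ) * PowerSeries.coeff n (T f : ℂ⟦X⟧) =
      (w (n + 1) : ℂ) * PowerSeries.coeff (n + 1) (f : ℂ⟦X⟧) := by
  rw [← inner_hardyMonomial, ← inner_hardyMonomial, ← hT.adjoint_hardyMonomial,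
    ContinuousLinearMap.adjoint_inner_left]

lemma apply_hardyMonomial_succ (hT : IsBackwardShift T) (n : ℕ) :
    T (hardyMonomial w (n + 1)) = ((w (n + 1) : ℂ) / w n) • hardyMonomial w n := by
  refine weightedHardy_ext fun m => ?_
  refine mul_left_cancel₀ (w.ofReal_ne_zero m) ?_
  rw [hT.mul_coeff_apply, Submodule.coe_smul, PowerSeries.coeff_smul, coeff_hardyMonomial,
    coeff_hardyMonomial]
  by_cases h : m = n
  · subst h
    have := w.ofReal_ne_zero m
    simp
    field_simp
  · simp [h]

lemma pow_apply_hardyMonomial (hT : IsBackwardShift T) (n k : ℕ) :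
    (T ^ k) (hardyMonomial w (n + k)) = ((w (n + k) : ℂ) / w n) • hardyMonomial w n := by
  induction k with
  | zero => simp [w.ofReal_ne_zero n]
  | succ k ih =>
    rw [pow_succ, mul_apply_eq_comp, ← add_assoc, hT.apply_hardyMonomial_succ, map_smul,
      ih, smul_smul, div_mul_div_cancel₀ (w.ofReal_ne_zero _)]

/-- A backward shift that is similar to `S*` is power bounded, which limits the growth of the
weight. -/
lemma exists_weight_le_of_areSimilar (hT : IsBackwardShift T)
    (hsim : AreSimilar T hardyBackwardShift) : ∃ C : ℝ, ∀ n k, w (n + k) ≤ C * w n := by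
  obtain ⟨A, hA⟩ := hsim
  have hpow : ∀ k x, A ((T ^ k) x) = (hardyBackwardShift ^ k) (A x) := by
    intro k
    induction k with
    | zero => intro x; simp
    | succ k ih =>
      intro x
      rw [pow_succ', pow_succ', mul_apply_eq_comp, mul_apply_eq_comp, hA, ih]
  have hS : ‖hardyBackwardShift‖ ≤ 1 := LinearMap.mkContinuous_norm_le _ zero_le_one _
  have hSk : ∀ k, ‖hardyBackwardShift ^ k‖ ≤ 1 := by
    intro k
    induction k with
    | zero =>
      rw [pow_zero]
      exact ContinuousLinearMap.norm_id_le
    | succ k ih =>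
      rw [pow_succ]
      exact (norm_mul_le _ _).trans (mul_le_one₀ ih (norm_nonneg _) hS)
  set B : ℝ := ‖(A.symm : HardySpace →L[ℂ] weightedHardy w)‖ *
    ‖(A : weightedHardy w →L[ℂ] HardySpace)‖ with hB
  have hbound : ∀ k x, ‖(T ^ k) x‖ ≤ B * ‖x‖ := by
    intro k x
    calc ‖(T ^ k) x‖ = ‖(A.symm : HardySpace →L[ℂ] weightedHardy w)
          ((hardyBackwardShift ^ k) (A x))‖ := by simp [← hpow]
      _ ≤ ‖(A.symm : HardySpace →L[ℂ] weightedHardy w)‖ *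
          (1 * (‖(A : weightedHardy w →L[ℂ] HardySpace)‖ * ‖x‖)) := by
          refine (ContinuousLinearMap.le_opNorm _ _).trans
            (mul_le_mul_of_nonneg_left ?_ (norm_nonneg _))
          refine (ContinuousLinearMap.le_opNorm _ _).trans
            (mul_le_mul (hSk k) ?_ (norm_nonneg _) zero_le_one)
          exact ContinuousLinearMap.le_opNorm (A : weightedHardy w →L[ℂ] HardySpace) x
      _ = B * ‖x‖ := by rw [hB]; ring
  refine ⟨B ^ 2, fun n k => ?_⟩
  have h := hbound k (hardyMonomial w (n + k))
  rw [hT.pow_apply_hardyMonomial, norm_smul] at h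
  have h2 := pow_le_pow_left₀ (by positivity) h 2
  have hn := w.pos n
  have hk := w.pos (n + k)
  rw [mul_pow, mul_pow, norm_hardyMonomial_sq, norm_hardyMonomial_sq, norm_div, Complex.norm_real,
    Complex.norm_real, Real.norm_of_nonneg hn.le, Real.norm_of_nonneg hk.le, div_pow,
    div_mul_eq_mul_div, div_le_iff₀ (by positivity)] at h2
  have h3 : w (n + k) * (w (n + k) * w n) ≤ (B ^ 2 * w n) * (w (n + k) * w n) := by linarith
  exact le_of_mul_le_mul_right h3 (by positivity)

end IsBackwardShift

/-- The eigenvector `∑ λⁿ zⁿ / wₙ` of the backward shift on `H²_w` for the eigenvalue `λ`. For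
`|λ| < 1` and `w ≥ 1` the series converges absolutely in `H²_w`; where it does not converge, the
value is `0`. -/
noncomputable def hardyEigenvector (w : HardyWeight) (z : ℂ) : weightedHardy w :=
  ∑' n, (z ^ n / (w n : ℂ)) • hardyMonomial w n

lemma norm_hardyEigenvector_term_le (hw : ∀ n, 1 ≤ w n) (z : ℂ) (n : ℕ) :
    ‖(z ^ n / (w n : ℂ)) • hardyMonomial w n‖ ≤ ‖z‖ ^ n := by
  refine le_of_sq_le_sq ?_ (by positivity)
  have hn := w.pos n
  rw [norm_smul, mul_pow, norm_hardyMonomial_sq, norm_div, norm_pow, Complex.norm_real,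
    Real.norm_of_nonneg hn.le, div_pow, div_mul_eq_mul_div, div_le_iff₀ (by positivity)]
  refine mul_le_mul_of_nonneg_left ?_ (by positivity)
  nlinarith [hw n]

lemma differentiableOn_hardyEigenvector (hw : ∀ n, 1 ≤ w n) :
    DifferentiableOn ℂ (hardyEigenvector w) (Metric.ball 0 1) := by
  intro z hz
  obtain ⟨ρ, hzρ, hρ1⟩ := exists_between (mem_ball_zero_iff.1 hz)
  have hρ0 : 0 ≤ ρ := (norm_nonneg z).trans hzρ.le
  have h := differentiableOn_tsum_of_summable_norm (U := Metric.ball (0 : ℂ) ρ)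
    (F := fun n z => (z ^ n / (w n : ℂ)) • hardyMonomial w n)
    (summable_geometric_of_lt_one hρ0 hρ1)
    (fun n => by fun_prop) Metric.isOpen_ball
    (fun n u hu => (norm_hardyEigenvector_term_le hw u n).trans
      (pow_le_pow_left₀ (norm_nonneg u) (mem_ball_zero_iff.1 hu).le n))
  exact (h.differentiableAt (Metric.isOpen_ball.mem_nhds
    (mem_ball_zero_iff.2 hzρ))).differentiableWithinAt

lemma coeff_hardyEigenvector (hw : ∀ n, 1 ≤ w n) {z : ℂ} (hz : ‖z‖ < 1) (m : ℕ) :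
    PowerSeries.coeff m (hardyEigenvector w z : ℂ⟦X⟧) = z ^ m / (w m : ℂ) := by
  have hs : Summable fun n => (z ^ n / (w n : ℂ)) • hardyMonomial w n :=
    Summable.of_norm_bounded (summable_geometric_of_lt_one (norm_nonneg z) hz)
      (norm_hardyEigenvector_term_le hw z)
  rw [← hardyCoeff_apply, hardyEigenvector, (hardyCoeff w m).map_tsum hs, tsum_eq_single m]
  · simp [hardyCoeff_apply, coeff_hardyMonomial]
  · intro n hn
    simp [hardyCoeff_apply, coeff_hardyMonomial, hn.symm]

lemma hasSum_norm_hardyEigenvector_sq (hw : ∀ n, 1 ≤ w n) {z : ℂ} (hz : ‖z‖ < 1) :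
    HasSum (fun n => (‖z‖ ^ 2) ^ n / w n) (‖hardyEigenvector w z‖ ^ 2) := by
  convert weightedHardy_hasSum_norm_sq w (hardyEigenvector w z) using 2 with n
  have hn := w.pos n
  rw [coeff_hardyEigenvector hw hz, norm_div, norm_pow, Complex.norm_real,
    Real.norm_of_nonneg hn.le]
  field_simp
  ring

lemma hardyEigenvector_ne_zero (hw : ∀ n, 1 ≤ w n) {z : ℂ} (hz : ‖z‖ < 1) :
    hardyEigenvector w z ≠ 0 := by
  intro h
  have h0 := coeff_hardyEigenvector hw hz 0
  rw [h] at h0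
  exact w.ofReal_ne_zero 0 (by simpa using h0.symm)

namespace IsBackwardShift

lemma eq_smul_hardyEigenvector (hT : IsBackwardShift T) (hw : ∀ n, 1 ≤ w n) {z : ℂ}
    (hz : ‖z‖ < 1) {f : weightedHardy w} (hf : f ∈ eigenFibre T z) :
    f = (hardyCoeff w 0 f * w 0) • hardyEigenvector w z := by
  have hf' : T f = z • f := by
    simpa [sub_eq_zero] using hf
  have hc : ∀ n, (w n : ℂ) * PowerSeries.coeff n (f : ℂ⟦X⟧) = hardyCoeff w 0 f * w 0 * z ^ n := by
    intro n
    induction n with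
    | zero => rw [hardyCoeff_apply]; ring
    | succ n ih =>
      rw [← hT.mul_coeff_apply, hf', Submodule.coe_smul, PowerSeries.coeff_smul, smul_eq_mul,
        mul_left_comm, ih]
      ring
  refine weightedHardy_ext fun n => ?_
  rw [Submodule.coe_smul, PowerSeries.coeff_smul, coeff_hardyEigenvector hw hz, smul_eq_mul,
    ← mul_div_assoc, ← hc, mul_div_cancel_left₀ _ (w.ofReal_ne_zero n)]

lemma hardyEigenvector_mem (hT : IsBackwardShift T) (hw : ∀ n, 1 ≤ w n) {z : ℂ} (hz : ‖z‖ < 1) :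
    hardyEigenvector w z ∈ eigenFibre T z := by
  have h : T (hardyEigenvector w z) = z • hardyEigenvector w z := by
    refine weightedHardy_ext fun n => mul_left_cancel₀ (w.ofReal_ne_zero n) ?_
    have h1 := w.ofReal_ne_zero n
    have h2 := w.ofReal_ne_zero (n + 1)
    rw [hT.mul_coeff_apply, Submodule.coe_smul, PowerSeries.coeff_smul,
      coeff_hardyEigenvector hw hz, coeff_hardyEigenvector hw hz, smul_eq_mul]
    field_simp
    ring
  simpa [sub_eq_zero] using h

lemma eigenFibre_eq_span (hT : IsBackwardShift T) (hw : ∀ n, 1 ≤ w n) {z : ℂ} (hz : ‖z‖ < 1) :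
    eigenFibre T z = Submodule.span ℂ {hardyEigenvector w z} := by
  refine le_antisymm (fun f hf => ?_) ?_
  · exact Submodule.mem_span_singleton.2 ⟨_, (hT.eq_smul_hardyEigenvector hw hz hf).symm⟩
  · rw [Submodule.span_singleton_le_iff_mem]
    exact hT.hardyEigenvector_mem hw hz

lemma isHolomorphicFrameAt (hT : IsBackwardShift T) (hw : ∀ n, 1 ≤ w n) {z : ℂ}
    (hz : z ∈ Metric.ball (0 : ℂ) 1) : IsHolomorphicFrameAt T (hardyEigenvector w) z := by
  filter_upwards [Metric.isOpen_ball.mem_nhds hz] with u hu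
  have hu' := mem_ball_zero_iff.1 hu
  exact ⟨(differentiableOn_hardyEigenvector hw).differentiableAt (Metric.isOpen_ball.mem_nhds hu),
    hardyEigenvector_ne_zero hw hu', hT.eigenFibre_eq_span hw hu'⟩

lemma hasEigenLineBundle (hT : IsBackwardShift T) (hw : ∀ n, 1 ≤ w n) : HasEigenLineBundle T where
  finrank_eq_one z hz := by
    have hz' := mem_ball_zero_iff.1 hz
    rw [hT.eigenFibre_eq_span hw hz']
    exact finrank_span_singleton (hardyEigenvector_ne_zero hw hz')
  dense_span := by
    rw [Submodule.topologicalClosure_eq_top_iff, Submodule.eq_bot_iff]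
    intro f hf
    -- The inner product of `f` with the eigenvectors is a power series in `z` whose coefficients
    -- are the conjugates of those of `f`.
    have hzero : ∀ z ∈ Metric.ball (0 : ℂ) 1, ⟪hardyEigenvector w z, f⟫ = 0 := fun z hz =>
      (Submodule.mem_orthogonal _ _).1 hf _ (Submodule.mem_iSup_of_mem z
        (Submodule.mem_iSup_of_mem hz (hT.hardyEigenvector_mem hw (mem_ball_zero_iff.1 hz))))
    set p := FormalMultilinearSeries.ofScalars ℂ
      (fun n => (starRingEnd ℂ) (PowerSeries.coeff n (f : ℂ⟦X⟧))) with hp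
    have hps : HasFPowerSeriesAt (0 : ℂ → ℂ) p 0 := by
      rw [hasFPowerSeriesAt_iff]
      filter_upwards [Metric.ball_mem_nhds (0 : ℂ) one_pos] with z hz
      have hz' := mem_ball_zero_iff.1 hz
      have hs : Summable fun n => (z ^ n / (w n : ℂ)) • hardyMonomial w n :=
        Summable.of_norm_bounded (summable_geometric_of_lt_one (norm_nonneg z) hz')
          (norm_hardyEigenvector_term_le hw z)
      have h1 := (innerSL ℂ f).hasSum hs.hasSum
      have h2 : (innerSL ℂ f) (∑' n, (z ^ n / (w n : ℂ)) • hardyMonomial w n) = 0 := by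
        change ⟪f, hardyEigenvector w z⟫ = 0
        rw [← inner_conj_symm, hzero z hz, map_zero]
      rw [h2] at h1
      rw [Pi.zero_apply]
      refine h1.congr_fun fun n => ?_
      have := w.ofReal_ne_zero n
      rw [hp, FormalMultilinearSeries.coeff_ofScalars, map_smul, innerSL_apply_apply,
        ← inner_conj_symm, inner_hardyMonomial, map_mul, Complex.conj_ofReal, smul_eq_mul,
        smul_eq_mul]
      field_simp
    have hp0 := hps.eq_zero
    refine weightedHardy_ext fun n => ?_
    have hn : p.coeff n = 0 := by rw [hp0]; rfl
    rw [hp, FormalMultilinearSeries.coeff_ofScalars] at hn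
    simpa using hn
  holomorphic z hz := ⟨_, hT.isHolomorphicFrameAt hw hz⟩

/-- If `‖γ_T‖² = F ‖γ_S‖²` for the eigenvectors of two backward shifts, then
`κ_S - κ_T = Δ log F`. -/
lemma eigenCurvature_sub {v : HardyWeight} {S : weightedHardy v →L[ℂ] weightedHardy v}
    (hT : IsBackwardShift T) (hS : IsBackwardShift S) (hw : ∀ n, 1 ≤ w n) (hv : ∀ n, 1 ≤ v n)
    {F : ℂ → ℝ} {z : ℂ} (hz : z ∈ Metric.ball (0 : ℂ) 1)
    (hF0 : ∀ u ∈ Metric.ball (0 : ℂ) 1, F u ≠ 0)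
    (hFc : ContDiffAt ℝ 2 (fun u => Real.log (F u)) z)
    (hF : ∀ u ∈ Metric.ball (0 : ℂ) 1,
      ‖hardyEigenvector w u‖ ^ 2 = F u * ‖hardyEigenvector v u‖ ^ 2) :
    eigenCurvature S z - eigenCurvature T z =
      normalizedLaplacian (fun u => Real.log (F u)) z := by
  have hfS := hS.isHolomorphicFrameAt hv hz
  rw [eigenCurvature_eq hfS, eigenCurvature_eq (hT.isHolomorphicFrameAt hw hz)]
  have hlog : (fun u => Real.log (‖hardyEigenvector w u‖ ^ 2)) =ᶠ[𝓝 z]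
      (fun u => Real.log (F u)) + fun u => Real.log (‖hardyEigenvector v u‖ ^ 2) := by
    filter_upwards [Metric.isOpen_ball.mem_nhds hz] with u hu
    have := norm_ne_zero_iff.2 (hardyEigenvector_ne_zero hv (mem_ball_zero_iff.1 hu))
    rw [hF u hu, Real.log_mul (hF0 u hu) (by positivity), Pi.add_apply]
  have hc := log_norm_sq_contDiffAt (hfS.mono fun u h => h.1) hfS.self_of_nhds.2.1
  rw [normalizedLaplacian, normalizedLaplacian, normalizedLaplacian,
    (InnerProductSpace.laplacian_congr_nhds hlog).self_of_nhds, hFc.laplacian_add hc]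
  ring

/-- The eigenvector bundles are uniformly equivalent, by the bundle map that takes eigenvectors to
eigenvectors, if the norms of the eigenvectors are comparable. -/
lemma uniformlyEquivalentBundles {v : HardyWeight} {S : weightedHardy v →L[ℂ] weightedHardy v}
    (hT : IsBackwardShift T) (hS : IsBackwardShift S) (hw : ∀ n, 1 ≤ w n) (hv : ∀ n, 1 ≤ v n)
    {c : ℝ} (hc : 0 < c)
    (hle : ∀ z ∈ Metric.ball (0 : ℂ) 1,
      c⁻¹ * ‖hardyEigenvector v z‖ ≤ ‖hardyEigenvector w z‖ ∧
        ‖hardyEigenvector w z‖ ≤ c * ‖hardyEigenvector v z‖) :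
    UniformlyEquivalentBundles S T := by
  classical
  -- `L f` is the coefficient of an eigenvector `f` of `S` with respect to the standard one.
  let L : weightedHardy v →L[ℂ] ℂ := (v 0 : ℂ) • hardyCoeff v 0
  have hLe : ∀ z ∈ Metric.ball (0 : ℂ) 1, ∀ f ∈ eigenFibre S z, f = L f • hardyEigenvector v z := by
    intro z hz f hf
    have h := hS.eq_smul_hardyEigenvector hv (mem_ball_zero_iff.1 hz) hf
    rwa [mul_comm] at h
  have hmem : ∀ z, ∀ f, (if z ∈ Metric.ball (0 : ℂ) 1 then L f • hardyEigenvector w z else 0) ∈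
      eigenFibre T z := by
    intro z f
    split_ifs with hz
    · exact Submodule.smul_mem _ _ (hT.hardyEigenvector_mem hw (mem_ball_zero_iff.1 hz))
    · exact Submodule.zero_mem _
  let Ψ : ∀ z : ℂ, eigenFibre S z →ₗ[ℂ] eigenFibre T z := fun z =>
    { toFun := fun f => ⟨_, hmem z f⟩
      map_add' := fun f g => Subtype.ext (by
        by_cases hz : z ∈ Metric.ball (0 : ℂ) 1 <;> simp [hz, add_smul])
      map_smul' := fun a f => Subtype.ext (by
        by_cases hz : z ∈ Metric.ball (0 : ℂ) 1 <;> simp [hz, smul_smul]) }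
  have hΨ : ∀ z ∈ Metric.ball (0 : ℂ) 1, ∀ f : eigenFibre S z,
      (Ψ z f : weightedHardy w) = L f • hardyEigenvector w z := fun z hz f => if_pos hz
  refine ⟨Ψ, fun z hz => ⟨?_, ?_⟩, fun U hU hUD σ hσ => ?_, c, hc, fun z hz f => ?_⟩
  · rw [injective_iff_map_eq_zero]
    intro f hf
    have h := hΨ z hz f
    rw [hf] at h
    have hL : L f = 0 := by
      simpa [hardyEigenvector_ne_zero hw (mem_ball_zero_iff.1 hz)] using h.symm
    refine Subtype.ext ?_
    rw [hLe z hz f f.2, hL, zero_smul]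
    rfl
  · intro g
    have hz' := mem_ball_zero_iff.1 hz
    set a : ℂ := hardyCoeff w 0 g * w 0 with ha
    refine ⟨⟨a • hardyEigenvector v z, Submodule.smul_mem _ _ (hS.hardyEigenvector_mem hv hz')⟩,
      Subtype.ext ?_⟩
    rw [hΨ z hz, hT.eq_smul_hardyEigenvector hw hz' g.2]
    congr 1
    simp [L, hardyCoeff_apply, coeff_hardyEigenvector hv hz', ha]
    field_simp [v.ofReal_ne_zero 0]
  · refine DifferentiableOn.congr (f := fun z => L (σ z) • hardyEigenvector w z) ?_
      fun z hz => hΨ z (hUD hz) (σ z)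
    exact (L.differentiable.comp_differentiableOn hσ).smul
      ((differentiableOn_hardyEigenvector hw).mono hUD)
  · have h1 : ‖f‖ = ‖L f‖ * ‖hardyEigenvector v z‖ := by
      rw [← norm_smul, ← hLe z hz f f.2]
      rfl
    have h2 : ‖Ψ z f‖ = ‖L f‖ * ‖hardyEigenvector w z‖ := by
      rw [← norm_smul, ← hΨ z hz f]
      rfl
    rw [h1, h2, mul_left_comm, mul_left_comm c]
    exact ⟨mul_le_mul_of_nonneg_left (hle z hz).1 (norm_nonneg _),
      mul_le_mul_of_nonneg_left (hle z hz).2 (norm_nonneg _)⟩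

end IsBackwardShift

end WeightedHardy

/-! ### The spikes -/

/-- The left end of the `k`-th spike; the growth makes `∑ (2 k + 1) / N k` small. -/
def spikePos (k : ℕ) : ℕ := 16 * 4 ^ k

lemma le_spikePos (k : ℕ) : k ≤ spikePos k := by
  have := (Nat.lt_pow_self (n := k) (by norm_num : 1 < 4)).le
  rw [spikePos]; omega

lemma spikePos_add_lt_succ (k : ℕ) : spikePos k + 2 * k < spikePos (k + 1) := by
  have := (Nat.lt_pow_self (n := k) (by norm_num : 1 < 4)).le
  have : 0 < 4 ^ k := by positivity
  rw [spikePos, spikePos, pow_succ]; omega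

lemma spikePos_strictMono : StrictMono spikePos :=
  strictMono_nat_of_lt_succ fun k => by have := spikePos_add_lt_succ k; omega

lemma spikePos_add_lt {k l : ℕ} (h : k < l) : spikePos k + 2 * k < spikePos l :=
  (spikePos_add_lt_succ k).trans_le (spikePos_strictMono.monotone h)

/-- The tent function of the `k`-th spike, with height `k` at the centre `N k + k`. The differences
are truncated. -/
def tent (k n : ℕ) : ℕ := k - ((spikePos k + k - n) + (n - (spikePos k + k)))

lemma tent_eq_zero {k n : ℕ} (h : n ∉ Set.Icc (spikePos k) (spikePos k + 2 * k)) :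
    tent k n = 0 := by
  rw [Set.mem_Icc] at h
  rw [tent]; omega

/-- The height of the spikes at `n`. The tents with `k > n` vanish at `n`. -/
def spikeHeight (n : ℕ) : ℕ := (Finset.range (n + 1)).sup fun k => tent k n

lemma tent_le_spikeHeight (k n : ℕ) : tent k n ≤ spikeHeight n := by
  by_cases hk : k < n + 1
  · exact Finset.le_sup (f := fun k => tent k n) (Finset.mem_range.2 hk)
  · rw [tent_eq_zero]
    · exact Nat.zero_le _
    · have := le_spikePos k
      rw [Set.mem_Icc]; omega

lemma spikeHeight_le {n m : ℕ} (h : ∀ k, tent k n ≤ m) : spikeHeight n ≤ m :=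
  Finset.sup_le fun k _ => h k

lemma spikeHeight_eq_tent {k n : ℕ} (h : n ∈ Set.Icc (spikePos k) (spikePos k + 2 * k)) :
    spikeHeight n = tent k n := by
  refine le_antisymm (spikeHeight_le fun l => ?_) (tent_le_spikeHeight k n)
  rcases lt_trichotomy l k with hl | rfl | hl
  · rw [tent_eq_zero]
    · exact Nat.zero_le _
    · have := spikePos_add_lt hl
      rw [Set.mem_Icc] at h ⊢; omega
  · exact le_rfl
  · rw [tent_eq_zero]
    · exact Nat.zero_le _
    · have := spikePos_add_lt hl
      rw [Set.mem_Icc] at h ⊢; omega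

lemma spikeHeight_eq_zero {n : ℕ}
    (h : ∀ k ≥ 1, n ∉ Set.Icc (spikePos k) (spikePos k + 2 * k)) : spikeHeight n = 0 := by
  refine Nat.le_zero.1 (spikeHeight_le fun k => ?_)
  rcases Nat.eq_zero_or_pos k with rfl | hk
  · simp [tent]
  · rw [tent_eq_zero (h k hk)]

lemma spikeHeight_succ_le (n : ℕ) : spikeHeight (n + 1) ≤ spikeHeight n + 1 :=
  spikeHeight_le fun k => by
    have := tent_le_spikeHeight k n
    rw [tent] at this ⊢; omega

lemma spikeHeight_le_succ (n : ℕ) : spikeHeight n ≤ spikeHeight (n + 1) + 1 :=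
  spikeHeight_le fun k => by
    have := tent_le_spikeHeight k (n + 1)
    rw [tent] at this ⊢; omega

/-- The weight `wₙ = (1 + α) ^ (2 hₙ)`, where `hₙ` is the height of the spikes at `n`. -/
noncomputable def spikeWeight (α : ℝ) (hα : 0 < α) : HardyWeight :=
  ⟨fun n => ((1 + α) ^ 2) ^ spikeHeight n, fun n => by positivity⟩

section SpikeWeight

variable {α : ℝ} (hα : 0 < α)

lemma spikeWeight_apply (n : ℕ) : spikeWeight α hα n = ((1 + α) ^ 2) ^ spikeHeight n := rfl

lemma one_lt_one_add_sq (hα : 0 < α) : 1 < (1 + α) ^ 2 := by nlinarith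

lemma one_le_spikeWeight (n : ℕ) : 1 ≤ spikeWeight α hα n :=
  one_le_pow₀ (one_lt_one_add_sq hα).le

lemma spikeWeight_succ_le (n : ℕ) :
    spikeWeight α hα (n + 1) ≤ (1 + α) ^ 2 * spikeWeight α hα n := by
  rw [spikeWeight_apply, spikeWeight_apply, ← pow_succ']
  exact pow_le_pow_right₀ (one_lt_one_add_sq hα).le (spikeHeight_succ_le n)

lemma spikeWeight_le_succ (n : ℕ) :
    spikeWeight α hα n ≤ (1 + α) ^ 2 * spikeWeight α hα (n + 1) := by
  rw [spikeWeight_apply, spikeWeight_apply, ← pow_succ']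
  exact pow_le_pow_right₀ (one_lt_one_add_sq hα).le (spikeHeight_le_succ n)

lemma log_spikeWeight (n : ℕ) :
    Real.log (spikeWeight α hα n) = 2 * spikeHeight n * Real.log (1 + α) := by
  rw [spikeWeight_apply, ← pow_mul, Real.log_pow]
  push_cast
  ring

lemma hasSpikes_spikeWeight : HasSpikes α spikePos (spikeWeight α hα) := by
  refine ⟨fun k _ j hj => ⟨?_, ?_⟩, fun n hn => ?_⟩
  · rw [log_spikeWeight, spikeHeight_eq_tent (k := k) (by rw [Set.mem_Icc]; omega)]
    rw [show tent k (spikePos k + j) = j by rw [tent]; omega]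
  · rw [log_spikeWeight, spikeHeight_eq_tent (k := k) (by rw [Set.mem_Icc]; omega)]
    rw [show tent k (spikePos k + 2 * k - j) = j by rw [tent]; omega]
  · rw [log_spikeWeight, spikeHeight_eq_zero hn]
    simp

lemma spikeWeight_unbounded_quotients (C : ℝ) :
    ∃ n k, C * spikeWeight α hα n < spikeWeight α hα (n + k) := by
  obtain ⟨k, hk⟩ := pow_unbounded_of_one_lt C (one_lt_one_add_sq hα)
  refine ⟨spikePos k, k, ?_⟩
  rw [spikeWeight_apply, spikeWeight_apply,
    spikeHeight_eq_tent (k := k) (n := spikePos k) (by rw [Set.mem_Icc]; omega),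
    spikeHeight_eq_tent (k := k) (n := spikePos k + k) (by rw [Set.mem_Icc]; omega),
    show tent k (spikePos k) = 0 by rw [tent]; omega,
    show tent k (spikePos k + k) = k by rw [tent]; omega]
  simpa using hk

/-- The deviation `1 - 1 / wₙ` of the reciprocal weight from that of the Hardy space. -/
noncomputable def spikeDeviation (n : ℕ) : ℝ := 1 - 1 / spikeWeight α hα n

lemma spikeDeviation_nonneg (n : ℕ) : 0 ≤ spikeDeviation hα n :=
  sub_nonneg.2 ((div_le_one ((spikeWeight α hα).pos n)).2 (one_le_spikeWeight hα n))

lemma spikeDeviation_le_one (n : ℕ) : spikeDeviation hα n ≤ 1 :=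
  sub_le_self _ (one_div_nonneg.2 ((spikeWeight α hα).pos n).le)

lemma spikeDeviation_eq_zero {n : ℕ}
    (h : ∀ k ≥ 1, n ∉ Set.Icc (spikePos k) (spikePos k + 2 * k)) : spikeDeviation hα n = 0 := by
  rw [spikeDeviation, spikeWeight_apply, spikeHeight_eq_zero h]
  simp

lemma spikeDeviation_zero : spikeDeviation hα 0 = 0 := by
  refine spikeDeviation_eq_zero hα fun k _ h => ?_
  have : 0 < spikePos k := by rw [spikePos]; positivity
  exact absurd h.1 (by omega)

/-- The spikes are sparse: the `k`-th one has `2 k + 1` points, all of them at least `16 · 4ᵏ`. -/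
lemma sum_spikeDeviation_le (M : ℕ) :
    ∑ n ∈ Finset.range M, spikeDeviation hα n / ((n : ℝ) + 1) ≤ 1 / 4 := by
  have hterm : ∀ n ∈ Finset.range M, spikeDeviation hα n / ((n : ℝ) + 1) ≤
      ∑ k ∈ Finset.range M,
        if n ∈ Finset.Icc (spikePos k) (spikePos k + 2 * k) then (1 / spikePos k : ℝ) else 0 := by
    intro n hn
    have hnn : ∀ k ∈ Finset.range M, (0 : ℝ) ≤
        if n ∈ Finset.Icc (spikePos k) (spikePos k + 2 * k) then (1 / spikePos k : ℝ) else 0 :=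
      fun k _ => by split_ifs <;> positivity
    by_cases h : ∃ k, n ∈ Finset.Icc (spikePos k) (spikePos k + 2 * k)
    · obtain ⟨k, hk⟩ := h
      have hk' := Finset.mem_Icc.1 hk
      have hkM : k ∈ Finset.range M := by
        have := le_spikePos k
        rw [Finset.mem_range] at hn ⊢; omega
      refine le_trans ?_ (Finset.single_le_sum hnn hkM)
      rw [if_pos hk]
      have hpos : (0 : ℝ) < spikePos k := by rw [spikePos]; positivity
      have hle : (spikePos k : ℝ) ≤ n := by exact_mod_cast hk'.1
      exact div_le_div₀ zero_le_one (spikeDeviation_le_one hα n) hpos (by linarith)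
    · push Not at h
      rw [spikeDeviation_eq_zero hα fun k _ hk => h k (Finset.mem_Icc.2 hk), zero_div]
      exact Finset.sum_nonneg hnn
  refine (Finset.sum_le_sum hterm).trans ?_
  rw [Finset.sum_comm]
  have hspike : ∀ k ∈ Finset.range M, ∑ n ∈ Finset.range M,
      (if n ∈ Finset.Icc (spikePos k) (spikePos k + 2 * k) then (1 / spikePos k : ℝ) else 0) ≤
        1 / 8 * (1 / 2) ^ k := by
    intro k _
    rw [← Finset.sum_filter, Finset.sum_const, nsmul_eq_mul]
    have hcard : ((Finset.range M).filter
        (· ∈ Finset.Icc (spikePos k) (spikePos k + 2 * k))).card ≤ 2 * k + 1 := by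
      refine (Finset.card_le_card (t := Finset.Icc (spikePos k) (spikePos k + 2 * k))
        fun n hn => (Finset.mem_filter.1 hn).2).trans ?_
      rw [Nat.card_Icc]; omega
    have hk : 2 * k + 1 ≤ 2 * 2 ^ k := by
      have := Nat.lt_two_pow_self (n := k)
      omega
    have hk' : (((Finset.range M).filter
        (· ∈ Finset.Icc (spikePos k) (spikePos k + 2 * k))).card : ℝ) ≤ 2 * 2 ^ k := by
      exact_mod_cast hcard.trans hk
    refine (mul_le_mul_of_nonneg_right hk' (by positivity)).trans (le_of_eq ?_)
    rw [spikePos]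
    push_cast
    rw [show (4 : ℝ) = 2 * 2 by norm_num, mul_pow, one_div_pow]
    field_simp
    norm_num
  refine (Finset.sum_le_sum hspike).trans ?_
  rw [← Finset.mul_sum]
  have := sum_geometric_two_le M
  linarith

lemma exists_hasSum_spikeDeviation :
    ∃ M ≤ 1 / 4, HasSum (fun n => spikeDeviation hα n / ((n : ℝ) + 1)) M := by
  have h0 : ∀ n, 0 ≤ spikeDeviation hα n / ((n : ℝ) + 1) := fun n =>
    div_nonneg (spikeDeviation_nonneg hα n) (by positivity)
  exact ⟨_, Real.tsum_le_of_sum_range_le h0 (sum_spikeDeviation_le hα),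
    (summable_of_sum_range_le h0 (sum_spikeDeviation_le hα)).hasSum⟩

/-- The eigenvectors satisfy `‖γ(z)‖² = (1 - (1 - r) Q'(r)) / (1 - r)` at `r = |z|²`, where
`Q'(r) = ∑ (1 - 1 / wₙ) rⁿ`. -/
lemma norm_hardyEigenvector_spikeWeight_sq {Q : ℕ → ℝ → ℝ}
    (hQ : ∀ r, Q 1 r = ∑' n, spikeDeviation hα n * r ^ n) {z : ℂ} (hz : ‖z‖ < 1) :
    ‖hardyEigenvector (spikeWeight α hα) z‖ ^ 2 =
      defect Q (‖z‖ ^ 2) * ‖hardyEigenvector HardyWeight.one z‖ ^ 2 := by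
  have hr0 : 0 ≤ ‖z‖ ^ 2 := by positivity
  have hr1 : ‖z‖ ^ 2 < 1 := (sq_lt_one_iff₀ (norm_nonneg z)).2 hz
  have h1 := hasSum_norm_hardyEigenvector_sq (w := HardyWeight.one) (fun _ => le_rfl) hz
  have hw := hasSum_norm_hardyEigenvector_sq (one_le_spikeWeight hα) hz
  have hg := hasSum_geometric_of_lt_one hr0 hr1
  have hone : ‖hardyEigenvector HardyWeight.one z‖ ^ 2 = (1 - ‖z‖ ^ 2)⁻¹ :=
    h1.unique (by simpa [HardyWeight.one] using hg)
  have hsub := hg.sub hw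
  have hQr : Q 1 (‖z‖ ^ 2) = (1 - ‖z‖ ^ 2)⁻¹ - ‖hardyEigenvector (spikeWeight α hα) z‖ ^ 2 := by
    rw [hQ, ← hsub.tsum_eq]
    refine tsum_congr fun n => ?_
    rw [spikeDeviation]
    ring
  rw [hone, defect, hQr]
  have : 1 - ‖z‖ ^ 2 ≠ 0 := by linarith
  field_simp
  ring

end SpikeWeight

theorem theorem1p5 (α : ℝ) (hα : 0 < α) :
    ∃ (N : ℕ → ℕ) (w : HardyWeight) (T : weightedHardy w →L[ℂ] weightedHardy w),
      (∀ k ≥ 1, N k + 2 * k < N (k + 1)) ∧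
      HasSpikes α N w ∧
      IsBackwardShift T ∧
      HasEigenLineBundle T ∧
      (∀ x, (1 - α) * ‖x‖ ≤ ‖ContinuousLinearMap.adjoint T x‖ ∧
        ‖ContinuousLinearMap.adjoint T x‖ ≤ (1 + α) * ‖x‖) ∧
      ¬ AreSimilar T hardyBackwardShift ∧
      UniformlyEquivalentBundles hardyBackwardShift T ∧
      HasBoundedSubharmonicSolution
        (fun z => |eigenCurvature hardyBackwardShift z - eigenCurvature T z|) ∧
      IsCarlesonMeasure (diskMeasure fun z =>
        |eigenCurvature hardyBackwardShift z - eigenCurvature T z| * (1 - ‖z‖)) ∧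
      ∃ C : ℝ, ∀ z ∈ Metric.ball (0 : ℂ) 1,
        |eigenCurvature hardyBackwardShift z - eigenCurvature T z| ^ (1 / 2 : ℝ) ≤
          C / (1 - ‖z‖) := by
  have hα1 : 0 ≤ 1 + α := by linarith
  have hw := one_le_spikeWeight hα
  have hone : ∀ n, 1 ≤ HardyWeight.one n := fun _ => le_rfl
  have hup := spikeWeight_succ_le hα
  have hdown := spikeWeight_le_succ hα
  set w := spikeWeight α hα
  set T := ContinuousLinearMap.adjoint (hardyForwardShift w hα1 hup) with hTdef
  have hT : IsBackwardShift T := isBackwardShift_adjoint_hardyForwardShift hα1 hup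
  have hS := isBackwardShift_hardyBackwardShift
  have hadj : ContinuousLinearMap.adjoint T = hardyForwardShift w hα1 hup :=
    ContinuousLinearMap.adjoint_adjoint _
  obtain ⟨M, hM4, hM⟩ := exists_hasSum_spikeDeviation hα
  obtain ⟨Q, hQ, hQ0, hQ1⟩ := exists_isAbsolutelyMonotone (spikeDeviation_nonneg hα)
    (spikeDeviation_le_one hα) hM
  have hQM : ∀ r, 0 ≤ r → r < 1 → Q 0 r ≤ 1 / 4 := fun r h0 h1 => (hQ0 r h0 h1).trans hM4
  have hQz : Q 1 0 = 0 := by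
    rw [hQ1, tsum_eq_single 0 fun n hn => by simp [hn], spikeDeviation_zero, zero_mul]
  have hr : ∀ z ∈ Metric.ball (0 : ℂ) 1, ‖z‖ ^ 2 ∈ Set.Ico (0 : ℝ) 1 := fun z hz =>
    ⟨by positivity, (sq_lt_one_iff₀ (norm_nonneg z)).2 (mem_ball_zero_iff.1 hz)⟩
  have hF : ∀ z ∈ Metric.ball (0 : ℂ) 1, ‖hardyEigenvector w z‖ ^ 2 =
      defect Q (‖z‖ ^ 2) * ‖hardyEigenvector HardyWeight.one z‖ ^ 2 := fun z hz =>
    norm_hardyEigenvector_spikeWeight_sq hα hQ1 (mem_ball_zero_iff.1 hz)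
  have hFhalf : ∀ r ∈ Set.Ico (0 : ℝ) 1, 1 / 2 ≤ defect Q r := fun r hr =>
    hQ.half_le_defect hQM hr.1 hr.2
  have hFone : ∀ r ∈ Set.Ico (0 : ℝ) 1, defect Q r ≤ 1 := fun r hr =>
    hQ.defect_le_one hr.1 hr.2
  have hu : ∀ r ∈ Set.Ico (0 : ℝ) 1, HasTwoContDerivsAt (fun t => Real.log (defect Q t))
      (logDefectDeriv Q) (logDefectDeriv₂ Q) r := fun r hr =>
    hQ.hasTwoContDerivsAt_logDefect hQM hr.1 hr.2
  set h : ℝ → ℝ := fun r => logDefectDeriv Q r + r * logDefectDeriv₂ Q r with hh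
  have hcurv : ∀ z ∈ Metric.ball (0 : ℂ) 1,
      eigenCurvature hardyBackwardShift z - eigenCurvature T z = h (‖z‖ ^ 2) := by
    intro z hz
    rw [hT.eigenCurvature_sub hS hw hone hz
      (fun u hu => by linarith [hFhalf _ (hr u hu)]) (hu _ (hr z hz)).contDiffAt_radial hF]
    exact (hu _ (hr z hz)).normalizedLaplacian_radial
  have hA : ∀ r ∈ Set.Ico (0 : ℝ) 1, (1 - r) * |h r| ≤ dominatingWeight Q r := fun r hr =>
    hQ.abs_logDefect_laplacian_le hQM hr.1 hr.2
  have hΦ : ∀ r ∈ Set.Ico (0 : ℝ) 1,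
      HasDerivAt (dominatingPotential Q) (dominatingWeight Q r) r := fun r hr =>
    hQ.hasDerivAt_dominatingPotential hr.1 hr.2
  have hΦM : ∀ r ∈ Set.Ico (0 : ℝ) 1, dominatingPotential Q r ≤ 72 := fun r hr =>
    hQ.dominatingPotential_le hQM hr.1 hr.2
  have hnorm : ∀ z ∈ Metric.ball (0 : ℂ) 1, 0 ≤ 1 - ‖z‖ ∧ 1 - ‖z‖ ≤ 1 - ‖z‖ ^ 2 := by
    intro z hz
    have h1 := mem_ball_zero_iff.1 hz
    have h0 := norm_nonneg z
    constructor <;> nlinarith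
  refine ⟨spikePos, w, T, fun k _ => spikePos_add_lt_succ k, hasSpikes_spikeWeight hα, hT,
    hT.hasEigenLineBundle hw, fun x => ?_, fun hsim => ?_, ?_, ?_, ?_, 18, fun z hz => ?_⟩
  · rw [hadj]
    refine ⟨?_, norm_hardyForwardShift_le hα1 hup x⟩
    have hle := le_norm_hardyForwardShift hα1 hup hdown x
    have hnn := norm_nonneg (hardyForwardShift w hα1 hup x)
    rcases le_total α 1 with h1 | h1
    -- The lower bound `1 / (1 + α)` of the quotients is larger than `1 - α`.
    · calc (1 - α) * ‖x‖ ≤ (1 - α) * ((1 + α) * ‖hardyForwardShift w hα1 hup x‖) :=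
            mul_le_mul_of_nonneg_left hle (by linarith)
        _ ≤ ‖hardyForwardShift w hα1 hup x‖ := by nlinarith [mul_nonneg (sq_nonneg α) hnn]
    · exact (mul_nonpos_of_nonpos_of_nonneg (by linarith) (norm_nonneg x)).trans hnn
  · obtain ⟨C, hC⟩ := hT.exists_weight_le_of_areSimilar hsim
    obtain ⟨n, k, hnk⟩ := spikeWeight_unbounded_quotients hα C
    exact absurd (hC n k) (not_le.2 hnk)
  · refine hT.uniformlyEquivalentBundles hS hw hone (c := 2) two_pos fun z hz => ?_
    have h1 := hFhalf _ (hr z hz)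
    have h2 := hFone _ (hr z hz)
    have hsq := hF z hz
    have hv := sq_nonneg ‖hardyEigenvector HardyWeight.one z‖
    constructor
    · refine le_of_sq_le_sq ?_ (norm_nonneg _)
      rw [hsq, mul_pow]
      exact mul_le_mul_of_nonneg_right (by norm_num; linarith) hv
    · refine le_of_sq_le_sq ?_ (by positivity)
      rw [hsq, mul_pow]
      exact mul_le_mul_of_nonneg_right (by linarith) hv
  · obtain ⟨φ, φ₁, φ₂, hφ, hφh, hφM⟩ := exists_bounded_radial_solution (Mu := Real.log 2) hu
      (fun r hr => by
        have h1 := hFhalf r hr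
        have h2 := Real.log_le_log (by norm_num) h1
        have h3 := Real.log_nonpos (by linarith) (hFone r hr)
        rw [one_div, Real.log_inv] at h2
        rw [abs_of_nonpos h3]
        linarith)
      (fun r hr => hQ.logDefect_laplacian_nonpos hQM hQz hr.1 hr.2) hA hΦ
      (fun r hr => hQ.dominatingPotential_nonneg hr.1 hr.2) hΦM
    refine ⟨fun z => φ (‖z‖ ^ 2), fun z hz => (hφ _ (hr z hz)).contDiffAt_radial.contDiffWithinAt,
      ⟨_, fun z hz => hφM _ (hr z hz)⟩, radial_isSubharmonicOn hφ fun r hr => ?_, fun z hz => ?_⟩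
    · rw [hφh r hr]
      exact abs_nonneg _
    · rw [(hφ _ (hr z hz)).normalizedLaplacian_radial, hφh _ (hr z hz)]
      simp only [hcurv z hz, hh]
  · refine isCarlesonMeasure_of_le_radial (M := 72) (by norm_num) (fun z hz => ?_)
      (fun r hr => hQ.dominatingWeight_nonneg hr.1 hr.2) hQ.continuousOn_dominatingWeight hΦ
      (hQ.dominatingPotential_nonneg le_rfl one_pos) hΦM
    rw [hcurv z hz, mul_comm]
    exact (mul_le_mul_of_nonneg_right (hnorm z hz).2 (abs_nonneg _)).trans (hA _ (hr z hz))
  · have hz0 : 0 < 1 - ‖z‖ := by linarith [mem_ball_zero_iff.1 hz]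
    have hb := hQ.sq_mul_abs_logDefect_laplacian_le hQM (hr z hz).1 (hr z hz).2
    rw [hcurv z hz, ← Real.sqrt_eq_rpow, le_div_iff₀ hz0]
    refine le_of_sq_le_sq ?_ (by norm_num)
    rw [mul_pow, Real.sq_sqrt (abs_nonneg _), mul_comm]
    exact (mul_le_mul_of_nonneg_right (pow_le_pow_left₀ hz0.le (hnorm z hz).2 2)
      (abs_nonneg _)).trans hb
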